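/- Work in a fixed countably saturated nonstandard universe, with set ${}^*\mathbb N$ of hyperintegers; countable saturation means that every sequence of internal sets with the finite intersection property has non-empty intersection. A set $X$ is *countably determined* (CD) if $$X=\bigcup_{b\in B}\Bigl(\bigcap_{m\in b}X_m\cap\bigcap_{m\notin b}\bigl(\textstyle\bigcup_n X_n\bigr)\setminus X_m\Bigr)$$ for some sequence of internal sets $X_m$ ($m\in\mathbb N$) and some $B\subseteq\mathcal P(\mathbb N)$; a map is CD if its graph is. For CD sets $X,Y$ write $X\le_{CD}Y$ if there is a CD injection $X\to Y$, $X\equiv_{CD}Y$ if $X\le_{CD}Y$ and $Y\le_{CD}X$, and $X<_{CD}Y$ if $X\le_{CD}Y$ but not $Y\le_{CD}X$. For an infinitely large $c\in{}^*\mathbb N$ put $$c\mathbb N=\{y\in{}^*\mathbb N: y<cn\text{ for some }n\in\mathbb N\},\qquad c/\mathbb N=\{y\in{}^*\mathbb N: yn<c\text{ for all }n\in\mathbb N\}.$$ For infinitely large $d\in{}^*\mathbb N$ and $G\subseteq\{0,1\}^{\mathbb N}$ let $M^d_G$ be the set of all internal functions $\xi:[0,d)\to\{0,1\}$ with $\xi{\restriction}\mathbb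 N\in G$. **Theorem.** Let $c=2^d\in{}^*\mathbb N\setminus\mathbb N$, where $d\in{}^*\mathbb N$, and let $X\subseteq c\mathbb N$ be a CD set. Then either $X<_{CD}c/\mathbb N$, or $X\equiv_{CD}M^d_G$ for some $G\subseteq\{0,1\}^{\mathbb N}$. -/

import Mathlib

universe u

/-- Names for the standard sets of finite type over the natural numbers:
`ℕ`, Cartesian products and power sets. -/
inductive StdType : Type
  | nat : StdType
  | prod : StdType → StdType → StdType
  | pow : StdType → StdType

/-- The standard set named by a type symbol. -/
@[reducible] def StdType.El : StdType → Type
  | .nat => ℕ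
  | .prod σ τ => StdType.El σ × StdType.El τ
  | .pow σ => Set (StdType.El σ)

/-- A countably saturated nonstandard universe over `ℕ`.

Every standard set `A` of finite type over `ℕ` has an extension `*A`, every standard map
`f : A → B` has an extension `*f : *A → *B`, every `S ⊆ A` has an extension `*S ⊆ *A`, and every
`a ∈ A` has a copy `*a ∈ *A`. The transfer principle is given in its algebraic form: the star
operation preserves composition, Cartesian products (with their coordinate maps), complements and
intersections (propositional connectives), preimages (substitution of terms) and images
(existential quantification); hence all first-order statements about sets of finite type hold for
the standard objects if and only if they hold for their extensions.

The elements of `*(P A)` stand for the internal subsets of `*A` (see `ext` below), and the field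
`saturation` is countable saturation. -/
structure NonstandardUniverse where
  Star : StdType → Type u
  star : ∀ {σ : StdType}, σ.El → Star σ
  map : ∀ {σ τ : StdType}, (σ.El → τ.El) → Star σ → Star τ
  starSet : ∀ {σ : StdType}, Set σ.El → Set (Star σ)
  pair : ∀ {σ τ : StdType}, Star σ → Star τ → Star (.prod σ τ)
  map_id : ∀ {σ : StdType} (x : Star σ), map (fun a : σ.El => a) x = x
  map_comp : ∀ {σ τ ρ : StdType} (g : τ.El → ρ.El) (f : σ.El → τ.El) (x : Star σ),
    map (fun a => g (f a)) x = map g (map f x)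
  map_fst_pair : ∀ {σ τ : StdType} (x : Star σ) (y : Star τ),
    map (σ := .prod σ τ) (τ := σ) Prod.fst (pair x y) = x
  map_snd_pair : ∀ {σ τ : StdType} (x : Star σ) (y : Star τ),
    map (σ := .prod σ τ) (τ := τ) Prod.snd (pair x y) = y
  pair_eta : ∀ {σ τ : StdType} (z : Star (.prod σ τ)),
    pair (map (σ := .prod σ τ) (τ := σ) Prod.fst z)
      (map (σ := .prod σ τ) (τ := τ) Prod.snd z) = z
  starSet_singleton : ∀ {σ : StdType} (a : σ.El), starSet {a} = {star a}
  starSet_compl : ∀ {σ : StdType} (S : Set σ.El), starSet Sᶜ = (starSet S)ᶜ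
  starSet_inter : ∀ {σ : StdType} (S T : Set σ.El), starSet (S ∩ T) = starSet S ∩ starSet T
  starSet_preimage : ∀ {σ τ : StdType} (f : σ.El → τ.El) (T : Set τ.El),
    starSet (f ⁻¹' T) = map f ⁻¹' starSet T
  starSet_image : ∀ {σ τ : StdType} (f : σ.El → τ.El) (S : Set σ.El),
    starSet (f '' S) = map f '' starSet S
  saturation : ∀ {σ : StdType} (A : ℕ → Star (.pow σ)),
    (∀ n : ℕ, ∃ x : Star σ, ∀ m ≤ n,
      pair x (A m) ∈ starSet (σ := .prod σ (.pow σ)) {p | p.1 ∈ p.2}) →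
    ∃ x : Star σ, ∀ m : ℕ, pair x (A m) ∈ starSet (σ := .prod σ (.pow σ)) {p | p.1 ∈ p.2}

namespace NonstandardUniverse

/-- The set of all `x ∈ *A` that belong, in the sense of the extended membership relation, to the
element `S` of `*(P A)`. -/
def ext (U : NonstandardUniverse.{u}) {σ : StdType} (S : U.Star (.pow σ)) : Set (U.Star σ) :=
  {x | U.pair x S ∈ U.starSet (σ := .prod σ (.pow σ)) {p | p.1 ∈ p.2}}

/-- Internal subsets of `*A`. -/
def IsInternal (U : NonstandardUniverse.{u}) {σ : StdType} (X : Set (U.Star σ)) : Prop :=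
  ∃ S : U.Star (.pow σ), U.ext S = X

/-- Countably determined sets:
`X = ⋃_{b ∈ B} (⋂_{m ∈ b} X_m ∩ ⋂_{m ∉ b} (⋃_n X_n) ∖ X_m)` with all `X_m` internal and
`B ⊆ P(ℕ)` arbitrary. -/
def IsCD (U : NonstandardUniverse.{u}) {σ : StdType} (X : Set (U.Star σ)) : Prop :=
  ∃ (A : ℕ → Set (U.Star σ)) (B : Set (Set ℕ)), (∀ m, U.IsInternal (A m)) ∧
    X = ⋃ b ∈ B, ((⋂ m ∈ b, A m) ∩ ⋂ m ∈ bᶜ, ((⋃ n, A n) \ A m))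

/-- `X ≤_CD Y`: there is an injection `θ : X → Y` whose graph is countably determined. -/
def CDLe (U : NonstandardUniverse.{u}) {σ τ : StdType}
    (X : Set (U.Star σ)) (Y : Set (U.Star τ)) : Prop :=
  ∃ θ : U.Star σ → U.Star τ, Set.MapsTo θ X Y ∧ Set.InjOn θ X ∧
    U.IsCD ((fun x => U.pair x (θ x)) '' X)

/-- `X <_CD Y`. -/
def CDLt (U : NonstandardUniverse.{u}) {σ τ : StdType}
    (X : Set (U.Star σ)) (Y : Set (U.Star τ)) : Prop :=
  U.CDLe X Y ∧ ¬ U.CDLe Y X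

/-- `X ≡_CD Y`. -/
def CDEquiv (U : NonstandardUniverse.{u}) {σ τ : StdType}
    (X : Set (U.Star σ)) (Y : Set (U.Star τ)) : Prop :=
  U.CDLe X Y ∧ U.CDLe Y X

/-- The order of the hyperintegers `*ℕ`. -/
def hlt (U : NonstandardUniverse.{u}) (x y : U.Star .nat) : Prop :=
  U.pair x y ∈ U.starSet (σ := .prod .nat .nat) {p | p.1 < p.2}

/-- The product of two hyperintegers. -/
def hmul (U : NonstandardUniverse.{u}) (x y : U.Star .nat) : U.Star .nat :=
  U.map (σ := .prod .nat .nat) (τ := .nat) (fun p => p.1 * p.2) (U.pair x y)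

/-- The hyperinteger `2 ^ d`. -/
def htwoPow (U : NonstandardUniverse.{u}) (d : U.Star .nat) : U.Star .nat :=
  U.map (σ := .nat) (τ := .nat) (fun k => 2 ^ k) d

/-- The standard natural number `n` as a hyperinteger. -/
def hnat (U : NonstandardUniverse.{u}) (n : ℕ) : U.Star .nat :=
  U.star (σ := .nat) n

/-- `cℕ`, the set of all `y` with `y < c n` for some `n ∈ ℕ`. -/
def mulCut (U : NonstandardUniverse.{u}) (c : U.Star .nat) : Set (U.Star .nat) :=
  {y | ∃ n : ℕ, U.hlt y (U.hmul c (U.hnat n))}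

/-- `c/ℕ`, the set of all `y` with `y n < c` for all `n ∈ ℕ`. -/
def divCut (U : NonstandardUniverse.{u}) (c : U.Star .nat) : Set (U.Star .nat) :=
  {y | ∀ n : ℕ, U.hlt (U.hmul y (U.hnat n)) c}

/-- The set `2^d` of all internal functions `ξ : [0,d) → {0,1}`, as internal sets of pairs. -/
def internalSeqs (U : NonstandardUniverse.{u}) (d : U.Star .nat) :
    Set (U.Star (.pow (.prod .nat .nat))) :=
  {ξ | (∀ k i, U.pair k i ∈ U.ext ξ → U.hlt k d ∧ U.hlt i (U.hnat 2)) ∧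
    ∀ k, U.hlt k d → ∃! i, U.pair k i ∈ U.ext ξ}

/-- `M^d_G`, the set of all internal `ξ : [0,d) → {0,1}` whose restriction to `ℕ` is an element
of `G`. -/
def monadUnion (U : NonstandardUniverse.{u}) (d : U.Star .nat) (G : Set (ℕ → Fin 2)) :
    Set (U.Star (.pow (.prod .nat .nat))) :=
  {ξ | ξ ∈ U.internalSeqs d ∧
    ∃ g ∈ G, ∀ n : ℕ, U.pair (U.hnat n) (U.hnat (g n : ℕ)) ∈ U.ext ξ}

end NonstandardUniverse

/-!
Write numbers `y < 2 ^ d` in binary; the digits at the standard places, counted from the leading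
one, form an element of `2^ℕ`, and the numbers with the same element of `2^ℕ` form a monad.

A countably determined `X ⊆ cℕ` is first moved into `[0, c)`: since the tail-equivalence classes of
`2^ℕ` are countably infinite, `2^ℕ × ℕ` embeds into `2^ℕ` by a map that changes only finitely many
terms of each sequence, and changing a given finite string of leading digits is internal.

Membership of `y` in `X` depends only on the signature of `y`, the sequence of truth values of
`y ∈ X_m`. Saturation extends `(X_m)` to an internal sequence, so an internal permutation of
`[0, c)` sorts all numbers with their signatures in increasing lexicographic order. Call a block of
numbers, given by finitely many leading digits and a finite part of the signature, negligible if its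
measure is infinitesimal. Again by saturation the negligible blocks lie in one internal set `Z` of
infinitesimal measure. If `X ⊆ Z`, then `X <_CD c/ℕ` by counting. Otherwise let `G` consist of the
digit sequences `g` such that, for some signature `b` of elements of `X`, no block around `(g, b)`
is negligible. Outside `Z` the set `X` is contained in the union of the monads of `G`, and one monad
has room for `Z`. Conversely, monotonicity leaves only countably many monads on which the signature
is not constant; each of these, if it belongs to `G`, is mapped internally into `X`, while the other
monads of `G` are subsets of `X`.
-/

namespace NonstandardUniverse

variable {U : NonstandardUniverse.{u}} {σ τ ρ υ : StdType}

/-! ### Transfer -/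

/-- The hyperelement `w` satisfies the extension of the standard predicate `P`. Universal and
existential quantifiers over standard objects inside `P` range over internal objects. -/
def Holds (U : NonstandardUniverse.{u}) {σ : StdType} (w : U.Star σ) (P : σ.El → Prop) : Prop :=
  w ∈ U.starSet {a | P a}

theorem starSet_empty : U.starSet (∅ : Set σ.El) = ∅ := by
  have h := U.starSet_inter (σ := σ) ∅ ∅ᶜ
  rwa [U.starSet_compl, Set.inter_compl_self, Set.inter_compl_self] at h

theorem starSet_univ : U.starSet (Set.univ : Set σ.El) = Set.univ := by
  rw [← Set.compl_empty, U.starSet_compl, starSet_empty, Set.compl_empty]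

theorem holds_and {w : U.Star σ} {P Q : σ.El → Prop} :
    U.Holds w (fun a => P a ∧ Q a) ↔ U.Holds w P ∧ U.Holds w Q :=
  Set.ext_iff.1 (U.starSet_inter {a | P a} {a | Q a}) w

theorem holds_not {w : U.Star σ} {P : σ.El → Prop} :
    U.Holds w (fun a => ¬ P a) ↔ ¬ U.Holds w P :=
  Set.ext_iff.1 (U.starSet_compl {a | P a}) w

theorem holds_of_forall {w : U.Star σ} {P : σ.El → Prop} (h : ∀ a, P a) : U.Holds w P := by
  have hP : {a | P a} = Set.univ := Set.eq_univ_of_forall h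
  simp only [Holds, hP, starSet_univ, Set.mem_univ]

theorem Holds.mono {w : U.Star σ} {P Q : σ.El → Prop} (hP : U.Holds w P)
    (h : ∀ a, P a → Q a) : U.Holds w Q := by
  have hPQ : (fun a => P a ∧ Q a) = P := funext fun a => propext (and_iff_left_of_imp (h a))
  exact (holds_and.1 (hPQ ▸ hP)).2

theorem Holds.mono₂ {w : U.Star σ} {P Q R : σ.El → Prop} (hP : U.Holds w P)
    (hQ : U.Holds w Q) (h : ∀ a, P a → Q a → R a) : U.Holds w R :=
  (holds_and.2 ⟨hP, hQ⟩).mono fun a ha => h a ha.1 ha.2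

theorem Holds.mono₃ {w : U.Star σ} {P Q R S : σ.El → Prop} (hP : U.Holds w P)
    (hQ : U.Holds w Q) (hR : U.Holds w R) (h : ∀ a, P a → Q a → R a → S a) : U.Holds w S :=
  (holds_and.2 ⟨hP, hQ⟩).mono₂ hR fun a ha => h a ha.1 ha.2

theorem holds_congr {w : U.Star σ} {P Q : σ.El → Prop} (h : ∀ a, P a ↔ Q a) :
    U.Holds w P ↔ U.Holds w Q :=
  ⟨fun hP => hP.mono fun a => (h a).1, fun hQ => hQ.mono fun a => (h a).2⟩

theorem holds_imp {w : U.Star σ} {P Q : σ.El → Prop} :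
    U.Holds w (fun a => P a → Q a) ↔ (U.Holds w P → U.Holds w Q) := by
  rw [← not_iff_not, ← holds_not, Classical.not_imp, ← holds_not, ← holds_and]
  exact holds_congr fun a => Classical.not_imp

theorem holds_or {w : U.Star σ} {P Q : σ.El → Prop} :
    U.Holds w (fun a => P a ∨ Q a) ↔ U.Holds w P ∨ U.Holds w Q := by
  rw [or_iff_not_imp_left, ← holds_not, ← holds_imp]
  exact holds_congr fun a => or_iff_not_imp_left

theorem holds_iff {w : U.Star σ} {P Q : σ.El → Prop} :
    U.Holds w (fun a => P a ↔ Q a) ↔ (U.Holds w P ↔ U.Holds w Q) := by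
  rw [iff_iff_implies_and_implies (a := U.Holds w P), ← holds_imp, ← holds_imp, ← holds_and]
  exact holds_congr fun a => iff_iff_implies_and_implies

theorem holds_const {w : U.Star σ} {p : Prop} : U.Holds w (fun _ => p) ↔ p := by
  by_cases hp : p
  · exact iff_of_true (holds_of_forall fun _ => hp) hp
  · exact iff_of_false (holds_not.1 (holds_of_forall fun _ => hp)) hp

theorem holds_forall_lt {w : U.Star σ} {P : ℕ → σ.El → Prop} {k : ℕ} :
    U.Holds w (fun a => ∀ i < k, P i a) ↔ ∀ i < k, U.Holds w (P i) := by
  induction k with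
  | zero => simp only [Nat.not_lt_zero, false_imp_iff, implies_true, holds_const]
  | succ k ih => simp only [Nat.forall_lt_succ_right, holds_and, ih]

theorem holds_map {w : U.Star σ} {f : σ.El → τ.El} {P : τ.El → Prop} :
    U.Holds (U.map f w) P ↔ U.Holds w (fun a => P (f a)) :=
  (Set.ext_iff.1 (U.starSet_preimage f {b | P b}) w).symm

theorem map_fst (x : U.Star σ) (y : U.Star τ) :
    U.map (σ := .prod σ τ) (τ := σ) (fun p => p.1) (U.pair x y) = x :=
  U.map_fst_pair x y

theorem map_snd (x : U.Star σ) (y : U.Star τ) :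
    U.map (σ := .prod σ τ) (τ := τ) (fun p => p.2) (U.pair x y) = y :=
  U.map_snd_pair x y

theorem map_map (g : τ.El → ρ.El) (f : σ.El → τ.El) (w : U.Star σ) :
    U.map g (U.map f w) = U.map (fun a => g (f a)) w :=
  (U.map_comp g f w).symm

theorem pair_map (f : σ.El → τ.El) (g : σ.El → ρ.El) (w : U.Star σ) :
    U.pair (U.map f w) (U.map g w) = U.map (τ := .prod τ ρ) (fun a => (f a, g a)) w := by
  rw [← U.pair_eta (U.map (τ := .prod τ ρ) (fun a => (f a, g a)) w), ← U.map_comp, ← U.map_comp]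

theorem pair_inj {x x' : U.Star σ} {y y' : U.Star τ} :
    U.pair x y = U.pair x' y' ↔ x = x' ∧ y = y' := by
  refine ⟨fun h => ⟨?_, ?_⟩, fun h => by rw [h.1, h.2]⟩
  · rw [← map_fst x y, h, map_fst]
  · rw [← map_snd x y, h, map_snd]

theorem map_const (a : τ.El) (w : U.Star σ) : U.map (fun _ => a) w = U.star a := by
  have h : U.Holds (U.map (fun _ : σ.El => a) w) (fun b => b = a) :=
    holds_map.2 (holds_of_forall fun _ => rfl)
  exact (Set.ext_iff.1 (U.starSet_singleton a) _).1 h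

theorem holds_pair_self {x y : U.Star σ} :
    U.Holds (σ := .prod σ σ) (U.pair x y) (fun p => p.1 = p.2) ↔ x = y := by
  have hdiag := U.starSet_image (σ := σ) (τ := .prod σ σ) (fun a => (a, a)) Set.univ
  have hrange : (fun a : σ.El => (a, a)) '' Set.univ = {p | p.1 = p.2} := by
    ext ⟨a, b⟩
    simp
  rw [hrange, starSet_univ, Set.image_univ] at hdiag
  refine (Set.ext_iff.1 hdiag _).trans ⟨?_, ?_⟩
  · rintro ⟨v, hv⟩
    rw [← pair_map (fun a => a) (fun a => a), U.map_id, pair_inj] at hv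
    exact hv.1.symm.trans hv.2
  · rintro rfl
    exact ⟨x, by rw [← pair_map (fun a => a) (fun a => a), U.map_id]⟩

theorem holds_eq {w : U.Star σ} {f g : σ.El → τ.El} :
    U.Holds w (fun a => f a = g a) ↔ U.map f w = U.map g w := by
  rw [← holds_pair_self, pair_map, holds_map]

theorem holds_pair_fst {z : U.Star ρ} {x : U.Star σ} {P : ρ.El → Prop} :
    U.Holds (σ := .prod ρ σ) (U.pair z x) (fun p => P p.1) ↔ U.Holds z P := by
  rw [← holds_map (U := U) (σ := .prod ρ σ) (f := fun p => p.1), map_fst]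

theorem holds_pair_snd {z : U.Star ρ} {x : U.Star σ} {P : σ.El → Prop} :
    U.Holds (σ := .prod ρ σ) (U.pair z x) (fun p => P p.2) ↔ U.Holds x P := by
  rw [← holds_map (U := U) (σ := .prod ρ σ) (f := fun p => p.2), map_snd]

/-- The internal relation `*P(z, x)`, regarded as a property of `x` with parameter `z`. -/
def Rel (U : NonstandardUniverse.{u}) {ρ σ : StdType} (P : ρ.El → σ.El → Prop) (z : U.Star ρ)
    (x : U.Star σ) : Prop :=
  U.Holds (σ := .prod ρ σ) (U.pair z x) (fun p => P p.1 p.2)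

theorem holds_exists {w : U.Star σ} {P : σ.El → τ.El → Prop} :
    U.Holds w (fun a => ∃ b, P a b) ↔ ∃ y, U.Rel P w y := by
  constructor
  · intro h
    obtain hτ | hτ := isEmpty_or_nonempty τ.El
    · exact (holds_const.1 (h.mono fun _ ⟨b, _⟩ => hτ.false b)).elim
    · let f (a : σ.El) : τ.El := Classical.epsilon (P a)
      have hw : U.pair w (U.map f w) = U.map (τ := .prod σ τ) (fun a => (a, f a)) w := by
        rw [← pair_map, U.map_id]
      refine ⟨U.map f w, ?_⟩
      rw [Rel, hw, holds_map]
      exact h.mono fun a => Classical.epsilon_spec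
  · rintro ⟨y, hy⟩
    exact holds_pair_fst.1 (hy.mono fun p hp => ⟨p.2, hp⟩)

theorem holds_forall {w : U.Star σ} {P : σ.El → τ.El → Prop} :
    U.Holds w (fun a => ∀ b, P a b) ↔ ∀ y, U.Rel P w y := by
  rw [← not_iff_not, ← holds_not, not_forall]
  simp only [Rel, ← holds_not]
  exact (holds_congr fun a => not_forall).trans (holds_exists (U := U) (P := fun a b => ¬ P a b))

/-! ### Internal sets and functions -/

theorem exists_joint (x : U.Star σ) (y : U.Star τ) : ∃ w : U.Star (.prod σ τ),
    U.map (σ := .prod σ τ) (fun p => p.1) w = x ∧ U.map (σ := .prod σ τ) (fun p => p.2) w = y :=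
  ⟨U.pair x y, map_fst x y, map_snd x y⟩

theorem exists_joint₃ (x : U.Star σ) (y : U.Star τ) (t : U.Star ρ) :
    ∃ w : U.Star (.prod σ (.prod τ ρ)), U.map (σ := .prod σ (.prod τ ρ)) (fun p => p.1) w = x ∧
      U.map (σ := .prod σ (.prod τ ρ)) (fun p => p.2.1) w = y ∧
      U.map (σ := .prod σ (.prod τ ρ)) (fun p => p.2.2) w = t := by
  obtain ⟨v, rfl, rfl⟩ := exists_joint y t
  obtain ⟨w, rfl, rfl⟩ := exists_joint x v
  exact ⟨w, rfl, (map_map (σ := .prod σ (.prod τ ρ)) (τ := .prod τ ρ) _ _ _).symm,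
    (map_map (σ := .prod σ (.prod τ ρ)) (τ := .prod τ ρ) _ _ _).symm⟩

/-- The internal function `x ↦ *f(z, x)` with parameter `z`. -/
def app (f : ρ.El → σ.El → τ.El) (z : U.Star ρ) (x : U.Star σ) : U.Star τ :=
  U.map (σ := .prod ρ σ) (fun p => f p.1 p.2) (U.pair z x)

theorem rel_map {P : ρ.El → τ.El → Prop} {f : σ.El → ρ.El} {g : σ.El → τ.El} {w : U.Star σ} :
    U.Rel P (U.map f w) (U.map g w) ↔ U.Holds w (fun a => P (f a) (g a)) := by
  rw [Rel, pair_map, holds_map]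

theorem app_map {F : ρ.El → τ.El → υ.El} {f : σ.El → ρ.El} {g : σ.El → τ.El} {w : U.Star σ} :
    app F (U.map f w) (U.map g w) = U.map (fun a => F (f a) (g a)) w := by
  rw [app, pair_map, map_map (τ := .prod ρ τ)]

theorem rel_map_left {P : ρ.El → σ.El → Prop} {f : τ.El → ρ.El} {z : U.Star τ} {x : U.Star σ} :
    U.Rel P (U.map f z) x ↔ U.Rel (fun a b => P (f a) b) z x := by
  obtain ⟨w, rfl, rfl⟩ := exists_joint z x
  rw [map_map (σ := .prod τ σ), rel_map, rel_map]

theorem app_map_left {F : ρ.El → σ.El → υ.El} {f : τ.El → ρ.El} {z : U.Star τ} :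
    app F (U.map f z) = app (fun a b => F (f a) b) z := by
  ext x
  obtain ⟨w, rfl, rfl⟩ := exists_joint z x
  rw [map_map (σ := .prod τ σ), app_map, app_map]

theorem rel_app {P : ρ.El → τ.El → Prop} {f : ρ.El → σ.El → τ.El} {z : U.Star ρ} {x : U.Star σ} :
    U.Rel P z (app f z x) ↔ U.Rel (fun a b => P a (f a b)) z x := by
  obtain ⟨w, rfl, rfl⟩ := exists_joint z x
  rw [app_map, rel_map, rel_map]

theorem app_app {f : ρ.El → σ.El → τ.El} {g : ρ.El → τ.El → υ.El} {z : U.Star ρ} {x : U.Star σ} :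
    app g z (app f z x) = app (fun a b => g a (f a b)) z x := by
  obtain ⟨w, rfl, rfl⟩ := exists_joint z x
  rw [app_map, app_map, app_map]

theorem mem_ext_iff {S : U.Star (.pow σ)} {x : U.Star σ} :
    x ∈ U.ext S ↔ U.Rel (ρ := .pow σ) (fun S b => b ∈ S) S x := by
  obtain ⟨w, rfl, rfl⟩ := exists_joint S x
  rw [rel_map, ext, Set.mem_ofPred, pair_map]
  exact holds_map (τ := .prod σ (.pow σ)) (P := fun p : σ.El × Set σ.El => p.1 ∈ p.2)

theorem mem_ext_map {V : ρ.El → Set σ.El} {z : U.Star ρ} {x : U.Star σ} :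
    x ∈ U.ext (U.map (τ := .pow σ) V z) ↔ U.Rel (fun a b => b ∈ V a) z x := by
  rw [mem_ext_iff, rel_map_left]

theorem map_mem_ext_map {V : ρ.El → Set σ.El} {f : ρ.El → σ.El} {z : U.Star ρ} :
    U.map f z ∈ U.ext (U.map (τ := .pow σ) V z) ↔ U.Holds z (fun a => f a ∈ V a) := by
  rw [mem_ext_iff, rel_map]

theorem isInternal_ext (S : U.Star (.pow σ)) : U.IsInternal (U.ext S) :=
  ⟨S, rfl⟩

theorem isInternal_rel (P : ρ.El → σ.El → Prop) (z : U.Star ρ) :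
    U.IsInternal {x | U.Rel P z x} :=
  ⟨U.map (τ := .pow σ) (fun a => {b | P a b}) z, Set.ext fun _ => mem_ext_map⟩

theorem isInternal_holds (P : σ.El → Prop) : U.IsInternal {x | U.Holds x P} := by
  convert isInternal_rel (U := U) (ρ := .nat) (fun _ b => P b) (U.star 0) using 1
  exact Set.ext fun _ => holds_pair_snd.symm

theorem isInternal_univ : U.IsInternal (Set.univ : Set (U.Star σ)) := by
  convert isInternal_holds (U := U) (fun _ : σ.El => True) using 1
  exact (Set.eq_univ_of_forall fun _ => holds_const.2 trivial).symm

theorem IsInternal.compl {X : Set (U.Star σ)} (h : U.IsInternal X) : U.IsInternal Xᶜ := by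
  obtain ⟨S, rfl⟩ := h
  refine ⟨U.map (σ := .pow σ) (τ := .pow σ) (fun S => Sᶜ) S, Set.ext fun x => ?_⟩
  rw [Set.mem_compl_iff, mem_ext_map (ρ := .pow σ), mem_ext_iff]
  exact holds_not

theorem IsInternal.inter {X Y : Set (U.Star σ)} (h : U.IsInternal X) (h' : U.IsInternal Y) :
    U.IsInternal (X ∩ Y) := by
  obtain ⟨S, rfl⟩ := h
  obtain ⟨T, rfl⟩ := h'
  obtain ⟨w, rfl, rfl⟩ := exists_joint S T
  refine ⟨U.map (σ := .prod (.pow σ) (.pow σ)) (τ := .pow σ) (fun p => p.1 ∩ p.2) w,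
    Set.ext fun x => ?_⟩
  simp only [Set.mem_inter_iff, mem_ext_map (ρ := .prod (.pow σ) (.pow σ))]
  exact holds_and

theorem IsInternal.forall_lt {A : ℕ → Set (U.Star σ)} (hA : ∀ m, U.IsInternal (A m)) (k : ℕ) :
    U.IsInternal {x | ∀ m < k, x ∈ A m} := by
  induction k with
  | zero => simpa using isInternal_univ
  | succ k ih =>
    simp only [Nat.forall_lt_succ_right]
    exact ih.inter (hA k)

theorem IsInternal.mem_iff {A : Set (U.Star σ)} (hA : U.IsInternal A) (p : Prop) :
    U.IsInternal {x | x ∈ A ↔ p} := by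
  by_cases hp : p
  · simpa [hp] using hA
  · simp only [hp, iff_false]
    exact hA.compl

/-- Internal functions, encoded by a standard family of functions and an internal parameter. -/
def InternalFun (F : U.Star σ → U.Star τ) : Prop :=
  ∃ (ρ : StdType) (z : U.Star ρ) (f : ρ.El → σ.El → τ.El), F = app f z

theorem internalFun_app (f : ρ.El → σ.El → τ.El) (z : U.Star ρ) : InternalFun (app f z) :=
  ⟨ρ, z, f, rfl⟩

theorem internalFun_map (f : σ.El → τ.El) : InternalFun (U := U) (U.map f) := by
  refine ⟨.nat, U.star 0, fun _ b => f b, funext fun x => ?_⟩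
  rw [app, ← map_map (σ := .prod .nat σ) (τ := σ) f (fun p => p.2), map_snd]

theorem internalFun_id : InternalFun (U := U) (fun x : U.Star σ => x) := by
  exact (funext U.map_id : U.map (fun a : σ.El => a) = _) ▸ internalFun_map _

theorem internalFun_fst : InternalFun (U := U) (U.map (σ := .prod σ τ) (τ := σ) Prod.fst) :=
  internalFun_map _

theorem internalFun_snd : InternalFun (U := U) (U.map (σ := .prod σ τ) (τ := τ) Prod.snd) :=
  internalFun_map _

theorem InternalFun.comp {F : U.Star τ → U.Star υ} {G : U.Star σ → U.Star τ}
    (hF : InternalFun F) (hG : InternalFun G) : InternalFun (fun x => F (G x)) := by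
  obtain ⟨ρ, z, f, rfl⟩ := hF
  obtain ⟨ρ', z', g, rfl⟩ := hG
  obtain ⟨w, rfl, rfl⟩ := exists_joint z z'
  simp only [app_map_left, app_app]
  exact internalFun_app _ _

theorem InternalFun.pair {F : U.Star σ → U.Star τ} {G : U.Star σ → U.Star ρ}
    (hF : InternalFun F) (hG : InternalFun G) : InternalFun (fun x => U.pair (F x) (G x)) := by
  obtain ⟨υ, z, f, rfl⟩ := hF
  obtain ⟨υ', z', g, rfl⟩ := hG
  obtain ⟨w, rfl, rfl⟩ := exists_joint z z'
  refine ⟨_, w, fun p b => (f p.1 b, g p.2 b), funext fun x => ?_⟩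
  rw [app_map_left, app_map_left]
  exact pair_map (σ := .prod (.prod υ υ') σ) (fun p => f p.1.1 p.2) (fun p => g p.1.2 p.2) _

theorem IsInternal.preimage {X : Set (U.Star τ)} (hX : U.IsInternal X) {F : U.Star σ → U.Star τ}
    (hF : InternalFun F) : U.IsInternal (F ⁻¹' X) := by
  obtain ⟨S, rfl⟩ := hX
  obtain ⟨ρ, z, f, rfl⟩ := hF
  obtain ⟨w, rfl, rfl⟩ := exists_joint S z
  convert isInternal_rel (U := U) (ρ := .prod (.pow τ) ρ) (fun p b => f p.2 b ∈ p.1) w using 1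
  ext x
  rw [Set.mem_preimage, mem_ext_map (ρ := .prod (.pow τ) ρ), app_map_left, rel_app,
    Set.mem_ofPred]

theorem InternalFun.isInternal_eq {F G : U.Star σ → U.Star τ} (hF : InternalFun F)
    (hG : InternalFun G) : U.IsInternal {x | F x = G x} := by
  convert (isInternal_holds (U := U) (σ := .prod τ τ) (fun p => p.1 = p.2)).preimage
    (hF.pair hG) using 1
  exact Set.ext fun _ => holds_pair_self.symm

theorem forall_star_prod {p : U.Star (.prod σ τ) → Prop} :
    (∀ w, p w) ↔ ∀ x y, p (U.pair x y) :=
  ⟨fun h _ _ => h _, fun h w => U.pair_eta w ▸ h _ _⟩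

theorem holds_existsUnique {w : U.Star σ} {P : σ.El → τ.El → Prop} :
    U.Holds w (fun a => ∃! b, P a b) ↔ ∃! y, U.Rel P w y := by
  have hpair : ∀ x y, U.Rel (σ := .prod τ τ) (fun a p => P a p.1 → P a p.2 → p.1 = p.2) w
      (U.pair x y) ↔ (U.Rel P w x → U.Rel P w y → x = y) := fun x y => by
    obtain ⟨v, rfl, rfl, rfl⟩ := exists_joint₃ w x y
    simp only [pair_map, rel_map, ← holds_eq, ← holds_imp]
  have hsplit : ∀ a, (∃! b, P a b) ↔
      (∃ b, P a b) ∧ ∀ p : (StdType.prod τ τ).El, P a p.1 → P a p.2 → p.1 = p.2 := fun a =>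
    ⟨fun h => ⟨h.exists, fun _ => h.unique⟩, fun h => existsUnique_of_exists_of_unique h.1
      fun b c => h.2 (b, c)⟩
  rw [holds_congr hsplit, holds_and, holds_exists, holds_forall (τ := .prod τ τ), forall_star_prod]
  simp only [hpair]
  exact ⟨fun h => existsUnique_of_exists_of_unique h.1 h.2,
    fun h => ⟨h.exists, fun _ _ => h.unique⟩⟩

theorem holds_forall_mem {z : U.Star ρ} {V : ρ.El → Set σ.El} {P : ρ.El → σ.El → Prop} :
    U.Holds z (fun a => ∀ b ∈ V a, P a b) ↔ ∀ x ∈ U.ext (U.map (τ := .pow σ) V z), U.Rel P z x := by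
  rw [holds_forall]
  refine forall_congr' fun x => ?_
  rw [mem_ext_map]
  exact holds_imp

theorem mapsTo_app_iff {z : U.Star ρ} {f : ρ.El → σ.El → τ.El} {V : ρ.El → Set σ.El}
    {W : ρ.El → Set τ.El} :
    Set.MapsTo (app f z) (U.ext (U.map (τ := .pow σ) V z)) (U.ext (U.map (τ := .pow τ) W z)) ↔
      U.Holds z (fun a => Set.MapsTo (f a) (V a) (W a)) := by
  refine (forall₂_congr fun x _ => ?_).trans (holds_forall_mem (P := fun a b => f a b ∈ W a)).symm
  rw [mem_ext_map, rel_app]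

theorem injOn_app_iff {z : U.Star ρ} {f : ρ.El → σ.El → τ.El} {V : ρ.El → Set σ.El} :
    Set.InjOn (app f z) (U.ext (U.map (τ := .pow σ) V z)) ↔
      U.Holds z (fun a => Set.InjOn (f a) (V a)) := by
  have hpairs : U.Holds z (fun a => Set.InjOn (f a) (V a)) ↔ U.Holds z (fun a =>
      ∀ p : (StdType.prod σ σ).El, p.1 ∈ V a → p.2 ∈ V a → f a p.1 = f a p.2 → p.1 = p.2) :=
    holds_congr fun a => ⟨fun h p hx hy => h hx hy, fun h _ hx _ hy => h (_, _) hx hy⟩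
  have hpair : ∀ x y, U.Rel (σ := .prod σ σ)
      (fun a p => p.1 ∈ V a → p.2 ∈ V a → f a p.1 = f a p.2 → p.1 = p.2) z (U.pair x y) ↔
      (x ∈ U.ext (U.map (τ := .pow σ) V z) → y ∈ U.ext (U.map (τ := .pow σ) V z) →
        app f z x = app f z y → x = y) := by
    intro x y
    obtain ⟨w, rfl, rfl, rfl⟩ := exists_joint₃ z x y
    simp only [mem_ext_map, app_map, rel_map, ← holds_eq, ← holds_imp, pair_map]
  rw [hpairs, holds_forall, forall_star_prod]
  exact ⟨fun h x y => (hpair x y).2 fun hx hy => h hx hy,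
    fun h x hx y hy => (hpair x y).1 (h x y) hx hy⟩

theorem image_app_ext {z : U.Star ρ} {f : ρ.El → σ.El → τ.El} {V : ρ.El → Set σ.El} :
    app f z '' U.ext (U.map (τ := .pow σ) V z) =
      U.ext (U.map (τ := .pow τ) (fun a => f a '' V a) z) := by
  ext y
  rw [mem_ext_map (V := fun a => f a '' V a), Rel]
  refine Iff.trans (exists_congr fun x => ?_)
    (holds_exists (σ := .prod ρ τ) (P := fun p b => b ∈ V p.1 ∧ f p.1 b = p.2)).symm
  obtain ⟨w, rfl, rfl, rfl⟩ := exists_joint₃ z y x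
  rw [mem_ext_map, app_map, pair_map, rel_map, rel_map, ← holds_eq, ← holds_and]

/-! ### Saturation -/

theorem exists_forall_mem {ι : Type*} [Countable ι] {A : ι → Set (U.Star σ)}
    (hA : ∀ i, U.IsInternal (A i)) (h : ∀ s : Finset ι, ∃ x, ∀ i ∈ s, x ∈ A i) :
    ∃ x, ∀ i, x ∈ A i := by
  obtain hι | hι := isEmpty_or_nonempty ι
  · exact (h ∅).imp fun _ _ => hι.elim
  classical
  obtain ⟨e, he⟩ := exists_surjective_nat ι
  choose S hS using hA
  simp only [← hS] at h ⊢
  obtain ⟨x, hx⟩ := U.saturation (fun n => S (e n)) fun n => by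
    obtain ⟨x, hx⟩ := h ((Finset.range (n + 1)).image e)
    exact ⟨x, fun m hm =>
      hx _ (Finset.mem_image_of_mem e (Finset.mem_range.2 (Nat.lt_succ_of_le hm)))⟩
  exact ⟨x, he.forall.2 hx⟩

theorem exists_forall_rel {P : ℕ → ρ.El → σ.El → Prop} {z : U.Star ρ}
    (h : ∀ n, U.Holds z (fun a => ∃ b, ∀ m < n, P m a b)) : ∃ x, ∀ m, U.Rel (P m) z x :=
  exists_forall_mem (A := fun m => {x | U.Rel (P m) z x}) (fun m => isInternal_rel (P m) z)
    fun s => by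
      obtain ⟨n, hn⟩ := s.exists_nat_subset_range
      obtain ⟨x, hx⟩ := holds_exists.1 (h n)
      exact ⟨x, fun m hm =>
        (holds_forall_lt (σ := .prod ρ σ)).1 hx m (Finset.mem_range.1 (hn hm))⟩

theorem exists_injOn_of_injOn_iInter {P : ℕ → Set (U.Star σ)} (hP : ∀ k, U.IsInternal (P k))
    (hanti : Antitone P) {F : U.Star σ → U.Star τ} (hF : InternalFun F)
    (hinj : Set.InjOn F (⋂ k, P k)) : ∃ k, Set.InjOn F (P k) := by
  by_contra! hno
  let fst := U.map (σ := .prod σ σ) (τ := σ) Prod.fst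
  let snd := U.map (σ := .prod σ σ) (τ := σ) Prod.snd
  have hsat : ∃ w, ∀ k, w ∈ fst ⁻¹' P k ∩ snd ⁻¹' P k ∩
      ({w | F (fst w) = F (snd w)} ∩ {w | fst w = snd w}ᶜ) := by
    refine exists_forall_mem (fun k => ?_) fun s => ?_
    · exact (((hP k).preimage internalFun_fst).inter ((hP k).preimage internalFun_snd)).inter
        (((hF.comp internalFun_fst).isInternal_eq (hF.comp internalFun_snd)).inter
          (internalFun_fst.isInternal_eq internalFun_snd).compl)
    · obtain ⟨n, hn⟩ := s.exists_le
      obtain ⟨x, hx, y, hy, hxy, hne⟩ :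
          ∃ x ∈ P n, ∃ y ∈ P n, F x = F y ∧ x ≠ y := by
        simpa only [Set.InjOn, not_forall, exists_prop] using hno n
      refine ⟨U.pair x y, fun m hm => ?_⟩
      have hfst : fst (U.pair x y) = x := U.map_fst_pair x y
      have hsnd : snd (U.pair x y) = y := U.map_snd_pair x y
      simp only [Set.mem_inter_iff, Set.mem_preimage, Set.mem_compl_iff, Set.mem_ofPred,
        hfst, hsnd]
      exact ⟨⟨hanti (hn m hm) hx, hanti (hn m hm) hy⟩, hxy, hne⟩
  obtain ⟨w, hw⟩ := hsat
  exact (hw 0).2.2 (hinj (Set.mem_iInter.2 fun k => (hw k).1.1)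
    (Set.mem_iInter.2 fun k => (hw k).1.2) (hw 0).2.1)

theorem exists_subset_biUnion_of_subset_iUnion {ι : Type*} [Countable ι] {S : Set (U.Star σ)}
    (hS : U.IsInternal S) {A : ι → Set (U.Star σ)} (hA : ∀ i, U.IsInternal (A i))
    (h : S ⊆ ⋃ i, A i) : ∃ s : Finset ι, S ⊆ ⋃ i ∈ s, A i := by
  by_contra! hno
  obtain ⟨x, hx⟩ := exists_forall_mem (ι := Option ι) (A := fun o => o.elim S fun i => (A i)ᶜ)
    (by rintro (_ | i); exacts [hS, (hA i).compl]) fun s => by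
      obtain ⟨x, hxS, hx⟩ := Set.not_subset.1 (hno s.eraseNone)
      simp only [Set.mem_iUnion, not_exists] at hx
      refine ⟨x, ?_⟩
      rintro (_ | i) hi
      exacts [hxS, hx i (Finset.mem_eraseNone.2 hi)]
  obtain ⟨i, hi⟩ := Set.mem_iUnion.1 (h (hx none))
  exact hx (some i) hi

/-! ### Internal selection -/

/-- A function whose graph is contained in `S` wherever that is possible. It turns elements of
`P(A × B)` into functions, so that internal relations can serve as codes of internal functions. -/
noncomputable def selector {α β : Type*} [Nonempty β] (S : Set (α × β)) (a : α) : β :=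
  Classical.epsilon fun b => (a, b) ∈ S

theorem mk_selector_mem {α β : Type*} [Nonempty β] {S : Set (α × β)} {a : α} {b : β}
    (h : (a, b) ∈ S) : (a, selector S a) ∈ S :=
  Classical.epsilon_spec (p := fun b => (a, b) ∈ S) ⟨b, h⟩

theorem selector_graph {α β : Type*} [Nonempty β] (f : α → β) :
    selector {p : α × β | f p.1 = p.2} = f :=
  funext fun a => (mk_selector_mem (S := {p : α × β | f p.1 = p.2}) (b := f a) rfl).symm

instance nonempty_el (σ : StdType) : Nonempty σ.El := by
  induction σ with
  | nat => exact ⟨(0 : ℕ)⟩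
  | prod _ _ h₁ h₂ => exact ⟨(h₁.some, h₂.some)⟩
  | pow _ _ => exact ⟨(∅ : Set _)⟩

instance nonempty_star : Nonempty (U.Star σ) :=
  (nonempty_el σ).map U.star

theorem IsInternal.exists_internalFun_mem {P : Set (U.Star (.prod σ τ))} (hP : U.IsInternal P) :
    ∃ F : U.Star σ → U.Star τ, InternalFun F ∧ ∀ x y, U.pair x y ∈ P → U.pair x (F x) ∈ P := by
  obtain ⟨S, rfl⟩ := hP
  refine ⟨app (ρ := .pow (.prod σ τ)) selector S, internalFun_app _ _, fun x y h => ?_⟩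
  obtain ⟨w, rfl, rfl, rfl⟩ := exists_joint₃ S x y
  rw [pair_map, mem_ext_iff, rel_map] at h
  rw [app_map, pair_map, mem_ext_iff, rel_map]
  exact h.mono fun p hp => mk_selector_mem hp

/-! ### Countably determined sets and maps -/

theorem mem_atom_iff {α : Type*} {A : ℕ → Set α} {b : Set ℕ} {x : α} :
    x ∈ (⋂ m ∈ b, A m) ∩ ⋂ m ∈ bᶜ, ((⋃ n, A n) \ A m) ↔ {m | x ∈ A m} = b ∧ b.Nonempty := by
  simp only [Set.mem_inter_iff, Set.mem_iInter, Set.mem_compl_iff, Set.mem_sdiff, Set.mem_iUnion]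
  constructor
  · rintro ⟨hb, hbc⟩
    have hx : {m | x ∈ A m} = b :=
      Set.Subset.antisymm (fun m hm => by_contra fun h => (hbc m h).2 hm) hb
    refine ⟨hx, Set.nonempty_iff_ne_empty.2 fun hempty => ?_⟩
    obtain ⟨n, hn⟩ := (hbc 0 (hempty ▸ Set.notMem_empty 0)).1
    exact Set.notMem_empty n (hempty ▸ hx ▸ hn)
  · rintro ⟨rfl, n, hn⟩
    exact ⟨fun m hm => hm, fun m hm => ⟨⟨n, hn⟩, hm⟩⟩

theorem IsCD.exists_eq {X : Set (U.Star σ)} (hX : U.IsCD X) :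
    ∃ (A : ℕ → Set (U.Star σ)) (B : Set (Set ℕ)), (∀ m, U.IsInternal (A m)) ∧
      X = {x | {m | x ∈ A m} ∈ B} := by
  obtain ⟨A, B, hA, rfl⟩ := hX
  refine ⟨A, {b ∈ B | b.Nonempty}, hA, Set.ext fun x => ?_⟩
  simp only [Set.mem_iUnion, mem_atom_iff, exists_prop]
  exact ⟨by rintro ⟨b, hb, rfl, hne⟩; exact ⟨hb, hne⟩, fun h => ⟨_, h.1, rfl, h.2⟩⟩

theorem isCD_of_isInternal {ι : Type*} [Countable ι] {A : ι → Set (U.Star σ)}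
    (hA : ∀ i, U.IsInternal (A i)) (Q : Set ι → Prop) : U.IsCD {x | Q {i | x ∈ A i}} := by
  -- The definition of `IsCD` cannot see the empty set of indices; the index `none` avoids this.
  obtain ⟨e, he⟩ := exists_surjective_nat (Option ι)
  have hA' : ∀ o : Option ι, U.IsInternal (o.elim Set.univ A) := by
    rintro (_ | i)
    exacts [isInternal_univ, hA i]
  refine ⟨fun n => (e n).elim Set.univ A, {b | Q {i | some i ∈ e '' b}}, fun n => hA' (e n), ?_⟩
  ext x
  have hindices : {i | some i ∈ e '' {n | x ∈ (e n).elim Set.univ A}} = {i | x ∈ A i} := by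
    ext i
    obtain ⟨n, hn⟩ := he (some i)
    refine ⟨fun ⟨m, hm, hmi⟩ => by simpa [hmi] using hm, fun hx => ⟨n, ?_, hn⟩⟩
    simpa [hn] using hx
  obtain ⟨n, hn⟩ := he none
  simp only [Set.mem_iUnion, mem_atom_iff, exists_prop, Set.mem_ofPred]
  constructor
  · exact fun hx => ⟨_, hindices.symm ▸ hx, rfl, n, by simp [hn]⟩
  · rintro ⟨b, hb, rfl, -⟩
    exact hindices ▸ hb

theorem isCD_of_isCD {ι : Type*} [Countable ι] {A : ι → Set (U.Star σ)}
    (hA : ∀ i, U.IsCD (A i)) (Q : Set ι → Prop) : U.IsCD {x | Q {i | x ∈ A i}} := by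
  choose A' B hA' hX using fun i => (hA i).exists_eq
  have hX' : ∀ x i, x ∈ A i ↔ {m | x ∈ A' i m} ∈ B i := fun x i => by rw [hX i]; rfl
  simp only [hX']
  exact isCD_of_isInternal (A := fun p : ι × ℕ => A' p.1 p.2) (fun p => hA' p.1 p.2)
    fun S => Q {i | {m | (i, m) ∈ S} ∈ B i}

theorem IsInternal.isCD {X : Set (U.Star σ)} (h : U.IsInternal X) : U.IsCD X :=
  isCD_of_isInternal (ι := Unit) (fun _ => h) fun S => () ∈ S

theorem IsCD.compl {X : Set (U.Star σ)} (hX : U.IsCD X) : U.IsCD Xᶜ :=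
  isCD_of_isCD (ι := Unit) (fun _ => hX) fun S => () ∉ S

theorem IsCD.inter {X Y : Set (U.Star σ)} (hX : U.IsCD X) (hY : U.IsCD Y) : U.IsCD (X ∩ Y) :=
  isCD_of_isCD (ι := Bool) (A := fun b => cond b X Y) (Bool.rec hY hX)
    fun S => true ∈ S ∧ false ∈ S

theorem isCD_iUnion {ι : Type*} [Countable ι] {A : ι → Set (U.Star σ)} (hA : ∀ i, U.IsCD (A i)) :
    U.IsCD (⋃ i, A i) := by
  convert isCD_of_isCD hA (fun S => ∃ i, i ∈ S) using 1
  exact Set.ext fun x => Set.mem_iUnion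

theorem IsCD.preimage {X : Set (U.Star τ)} (hX : U.IsCD X) {F : U.Star σ → U.Star τ}
    (hF : InternalFun F) : U.IsCD (F ⁻¹' X) := by
  obtain ⟨A, B, hA, rfl⟩ := hX.exists_eq
  exact isCD_of_isInternal (A := fun m => F ⁻¹' A m) (fun m => (hA m).preimage hF) (· ∈ B)

/-- Maps that agree on `X` piecewise with countably many internal functions, the pieces being
countably determined. -/
def CDMap (θ : U.Star σ → U.Star τ) (X : Set (U.Star σ)) : Prop :=
  ∃ (ι : Type) (_ : Countable ι) (F : ι → U.Star σ → U.Star τ) (D : ι → Set (U.Star σ)),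
    (∀ i, InternalFun (F i)) ∧ (∀ i, U.IsCD (D i)) ∧ X ⊆ ⋃ i, D i ∧ ∀ i, Set.EqOn θ (F i) (X ∩ D i)

theorem InternalFun.cdMap {F : U.Star σ → U.Star τ} (hF : InternalFun F) (X : Set (U.Star σ)) :
    CDMap F X :=
  ⟨Unit, inferInstance, fun _ => F, fun _ => Set.univ, fun _ => hF, fun _ => isInternal_univ.isCD,
    fun _ _ => Set.mem_iUnion.2 ⟨(), trivial⟩, fun _ _ _ => rfl⟩

theorem CDMap.comp {θ' : U.Star τ → U.Star ρ} {θ : U.Star σ → U.Star τ} {X : Set (U.Star σ)}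
    {Y : Set (U.Star τ)} (h' : CDMap θ' Y) (h : CDMap θ X) (hXY : Set.MapsTo θ X Y) :
    CDMap (fun x => θ' (θ x)) X := by
  obtain ⟨ι, _, F, D, hF, hD, hX, h⟩ := h
  obtain ⟨ι', _, F', D', hF', hD', hY, h'⟩ := h'
  refine ⟨ι × ι', inferInstance, fun p x => F' p.2 (F p.1 x), fun p => D p.1 ∩ F p.1 ⁻¹' D' p.2,
    fun p => (hF' _).comp (hF _), fun p => (hD _).inter ((hD' _).preimage (hF _)),
    fun x hx => ?_, fun p x hx => ?_⟩
  · obtain ⟨i, hi⟩ := Set.mem_iUnion.1 (hX hx)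
    obtain ⟨j, hj⟩ := Set.mem_iUnion.1 (hY (hXY hx))
    rw [h i ⟨hx, hi⟩] at hj
    exact Set.mem_iUnion.2 ⟨(i, j), hi, hj⟩
  · have hθx := h p.1 ⟨hx.1, hx.2.1⟩
    have hY := hXY hx.1
    rw [hθx] at hY
    simp only [hθx, h' p.2 ⟨hY, hx.2.2⟩]

theorem CDMap.isCD_graph {θ : U.Star σ → U.Star τ} {X : Set (U.Star σ)} (h : CDMap θ X)
    (hX : U.IsCD X) : U.IsCD ((fun x => U.pair x (θ x)) '' X) := by
  obtain ⟨ι, _, F, D, hF, hD, hXD, h⟩ := h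
  convert isCD_iUnion (A := fun i => U.map (σ := .prod σ τ) (τ := σ) Prod.fst ⁻¹' (X ∩ D i) ∩
    {p | F i (U.map (σ := .prod σ τ) (τ := σ) Prod.fst p) =
      U.map (σ := .prod σ τ) (τ := τ) Prod.snd p})
    (fun i => ((hX.inter (hD i)).preimage internalFun_fst).inter
      (((hF i).comp internalFun_fst).isInternal_eq internalFun_snd).isCD) using 1
  ext p
  simp only [Set.mem_image, Set.mem_iUnion]
  constructor
  · rintro ⟨x, hx, rfl⟩
    obtain ⟨i, hi⟩ := Set.mem_iUnion.1 (hXD hx)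
    refine ⟨i, ?_⟩
    simp only [Set.mem_inter_iff, Set.mem_preimage, Set.mem_ofPred, U.map_fst_pair, U.map_snd_pair]
    exact ⟨⟨hx, hi⟩, (h i ⟨hx, hi⟩).symm⟩
  · rintro ⟨i, hxi, hp⟩
    exact ⟨_, hxi.1, by rw [h i hxi, hp, U.pair_eta]⟩

theorem CDMap.cdLe {θ : U.Star σ → U.Star τ} {X : Set (U.Star σ)} {Y : Set (U.Star τ)}
    (h : CDMap θ X) (hX : U.IsCD X) (hmaps : Set.MapsTo θ X Y) (hinj : Set.InjOn θ X) :
    U.CDLe X Y :=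
  ⟨θ, hmaps, hinj, h.isCD_graph hX⟩

/-- The set of all `x` such that, for `m < s.1`, membership in `A m` is prescribed by `s.2`. -/
def cylinder {α : Type*} (A : ℕ → Set α) (s : ℕ × Finset ℕ) : Set α :=
  {x | ∀ m < s.1, (x ∈ A m ↔ m ∈ s.2)}

theorem exists_cylinder_eq {α : Type*} (A : ℕ → Set α) (p : ℕ → Prop) (k : ℕ) :
    ∃ t, cylinder A (k, t) = {y | ∀ m < k, (y ∈ A m ↔ p m)} := by
  classical
  refine ⟨(Finset.range k).filter p, Set.ext fun y => forall₂_congr fun m hm => ?_⟩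
  simp only [Finset.mem_filter, Finset.mem_range, hm, true_and]

theorem isInternal_cylinder {A : ℕ → Set (U.Star σ)} (hA : ∀ m, U.IsInternal (A m))
    (s : ℕ × Finset ℕ) : U.IsInternal (cylinder A s) :=
  IsInternal.forall_lt (fun m => (hA m).mem_iff (m ∈ s.2)) s.1

theorem IsCD.exists_cover_injOn {X : Set (U.Star σ)} (hX : U.IsCD X) {F : U.Star σ → U.Star τ}
    (hF : InternalFun F) (hinj : Set.InjOn F X) :
    ∃ (ι : Type) (_ : Countable ι) (P : ι → Set (U.Star σ)),
      (∀ i, U.IsInternal (P i)) ∧ (∀ i, Set.InjOn F (P i)) ∧ X ⊆ ⋃ i, P i := by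
  obtain ⟨A, B, hA, rfl⟩ := hX.exists_eq
  refine ⟨{s // Set.InjOn F (cylinder A s)}, inferInstance, fun s => cylinder A s.1,
    fun s => isInternal_cylinder hA s.1, fun s => s.2, fun x hx => ?_⟩
  choose t ht using exists_cylinder_eq A (x ∈ A ·)
  have hanti : Antitone fun k => cylinder A (k, t k) := fun j k hjk y hy => by
    simp only [ht] at hy ⊢
    exact fun m hm => hy m (hm.trans_le hjk)
  have hsub : ⋂ k, cylinder A (k, t k) ⊆ {x | {m | x ∈ A m} ∈ B} := fun y hy => by
    have hsame : {m | y ∈ A m} = {m | x ∈ A m} := Set.ext fun m => by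
      have hm := Set.mem_iInter.1 hy (m + 1)
      rw [ht] at hm
      exact hm m m.lt_succ_self
    rwa [Set.mem_ofPred, hsame]
  obtain ⟨k, hk⟩ := exists_injOn_of_injOn_iInter (fun k => isInternal_cylinder hA (k, t k)) hanti hF
    (hinj.mono hsub)
  exact Set.mem_iUnion.2 ⟨⟨(k, t k), hk⟩, (ht k).symm ▸ fun _ _ => Iff.rfl⟩

theorem exists_internalFun_of_isCD_graph {θ : U.Star σ → U.Star τ} {X : Set (U.Star σ)}
    (hinj : Set.InjOn θ X) (hθ : U.IsCD ((fun x => U.pair x (θ x)) '' X)) :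
    ∃ (ι : Type) (_ : Countable ι) (F : ι → U.Star σ → U.Star τ) (E : ι → Set (U.Star σ)),
      (∀ i, InternalFun (F i)) ∧ (∀ i, U.IsInternal (E i)) ∧ (∀ i, Set.InjOn (F i) (E i)) ∧
      ∀ x ∈ X, ∃ i, x ∈ E i ∧ θ x = F i x := by
  have hfst : Set.InjOn (U.map (σ := .prod σ τ) (τ := σ) Prod.fst)
      ((fun x => U.pair x (θ x)) '' X) := by
    rintro _ ⟨x, -, rfl⟩ _ ⟨y, -, rfl⟩ h
    simp only [U.map_fst_pair] at h
    simp only [h]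
  have hsnd : Set.InjOn (U.map (σ := .prod σ τ) (τ := τ) Prod.snd)
      ((fun x => U.pair x (θ x)) '' X) := by
    rintro _ ⟨x, hx, rfl⟩ _ ⟨y, hy, rfl⟩ h
    simp only [U.map_snd_pair] at h
    simp only [hinj hx hy h]
  obtain ⟨ι, _, P, hP, hPfst, hXP⟩ := hθ.exists_cover_injOn internalFun_fst hfst
  obtain ⟨κ, _, Q, hQ, hQsnd, hXQ⟩ := hθ.exists_cover_injOn internalFun_snd hsnd
  have hPQ : ∀ i : ι × κ, U.IsInternal (P i.1 ∩ Q i.2) := fun i => (hP i.1).inter (hQ i.2)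
  choose F hF hmem using fun i => (hPQ i).exists_internalFun_mem
  refine ⟨ι × κ, inferInstance, F, fun i => (fun x => U.pair x (F i x)) ⁻¹' (P i.1 ∩ Q i.2), hF,
    fun i => (hPQ i).preimage (internalFun_id.pair (hF i)), fun i x hx y hy h => ?_,
    fun x hx => ?_⟩
  · exact (pair_inj.1 (hQsnd i.2 hx.2 hy.2 (by simpa only [U.map_snd_pair] using h))).1
  · obtain ⟨i, hi⟩ := Set.mem_iUnion.1 (hXP ⟨x, hx, rfl⟩)
    obtain ⟨j, hj⟩ := Set.mem_iUnion.1 (hXQ ⟨x, hx, rfl⟩)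
    have hFx := hmem (i, j) x (θ x) ⟨hi, hj⟩
    exact ⟨(i, j), hFx, (pair_inj.1 (hPfst i hi hFx.1 (by simp only [U.map_fst_pair]))).2⟩

theorem isCD_and_cdMap_of_isCD_graph {θ : U.Star σ → U.Star τ} {X : Set (U.Star σ)}
    (hinj : Set.InjOn θ X) (hθ : U.IsCD ((fun x => U.pair x (θ x)) '' X)) :
    U.IsCD X ∧ CDMap θ X := by
  obtain ⟨ι, _, F, E, hF, -, -, hFE⟩ := exists_internalFun_of_isCD_graph hinj hθ
  have hD : ∀ i, U.IsCD {x ∈ X | θ x = F i x} := fun i => by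
    convert hθ.preimage (internalFun_id.pair (hF i)) using 1
    ext x
    simp only [Set.mem_ofPred, Set.mem_preimage, Set.mem_image, pair_inj]
    exact ⟨fun hx => ⟨x, hx.1, rfl, hx.2⟩, by rintro ⟨y, hy, rfl, hθy⟩; exact ⟨hy, hθy⟩⟩
  have hcover : X ⊆ ⋃ i, {x ∈ X | θ x = F i x} := fun x hx =>
    Set.mem_iUnion.2 ((hFE x hx).imp fun i hi => ⟨hx, hi.2⟩)
  have hX : X = ⋃ i, {x ∈ X | θ x = F i x} :=
    hcover.antisymm (Set.iUnion_subset fun i => Set.sep_subset _ _)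
  exact ⟨hX ▸ isCD_iUnion hD, ι, inferInstance, F, _, hF, hD, hcover, fun i x hx => hx.2.2⟩

theorem CDLe.isCD {X : Set (U.Star σ)} {Y : Set (U.Star τ)} (h : U.CDLe X Y) : U.IsCD X := by
  obtain ⟨θ, -, hinj, hθ⟩ := h
  exact (isCD_and_cdMap_of_isCD_graph hinj hθ).1

theorem CDLe.trans {X : Set (U.Star σ)} {Y : Set (U.Star τ)} {Z : Set (U.Star ρ)}
    (h : U.CDLe X Y) (h' : U.CDLe Y Z) : U.CDLe X Z := by
  obtain ⟨θ, hm, hi, hg⟩ := h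
  obtain ⟨θ', hm', hi', hg'⟩ := h'
  obtain ⟨hX, hθ⟩ := isCD_and_cdMap_of_isCD_graph hi hg
  exact ((isCD_and_cdMap_of_isCD_graph hi' hg').2.comp hθ hm).cdLe hX (hm'.comp hm)
    (hi'.comp hi hm)

theorem CDEquiv.trans {X : Set (U.Star σ)} {Y : Set (U.Star τ)} {Z : Set (U.Star ρ)}
    (h : U.CDEquiv X Y) (h' : U.CDEquiv Y Z) : U.CDEquiv X Z :=
  ⟨h.1.trans h'.1, h'.2.trans h.2⟩

theorem CDEquiv.symm {X : Set (U.Star σ)} {Y : Set (U.Star τ)} (h : U.CDEquiv X Y) :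
    U.CDEquiv Y X :=
  ⟨h.2, h.1⟩

theorem CDEquiv.trans_cdLt {X : Set (U.Star σ)} {Y : Set (U.Star τ)} {Z : Set (U.Star ρ)}
    (h : U.CDEquiv X Y) (h' : U.CDLt Y Z) : U.CDLt X Z :=
  ⟨h.1.trans h'.1, fun hZX => h'.2 (hZX.trans h.1)⟩

theorem CDLe.of_subset {X Y : Set (U.Star σ)} (hX : U.IsCD X) (h : X ⊆ Y) : U.CDLe X Y :=
  (internalFun_id.cdMap X).cdLe hX h Function.injective_id.injOn

theorem CDMap.cdEquiv_image {θ : U.Star σ → U.Star τ} {X : Set (U.Star σ)} (h : CDMap θ X)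
    (hX : U.IsCD X) (hinj : Set.InjOn θ X) : U.CDEquiv X (θ '' X) := by
  refine ⟨h.cdLe hX (Set.mapsTo_image θ X) hinj, Function.invFunOn θ X, ?_, ?_, ?_⟩
  · exact fun y hy => Function.invFunOn_mem hy
  · exact Function.invFunOn_injOn_image θ X
  · convert (h.isCD_graph hX).preimage (internalFun_snd.pair internalFun_fst) using 1
    ext p
    rw [Set.image_image]
    constructor
    · rintro ⟨x, hx, rfl⟩
      refine ⟨x, hx, ?_⟩
      simp only [U.map_fst_pair, U.map_snd_pair, hinj.leftInvOn_invFunOn hx]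
    · rintro ⟨x, hx, hp⟩
      obtain ⟨hx', hy'⟩ := pair_inj.1 hp
      refine ⟨x, hx, ?_⟩
      simp only [hinj.leftInvOn_invFunOn hx]
      rw [hy', hx', U.pair_eta]

/-! ### Hyperfinite cardinalities -/

theorem ext_map_union (V W : ρ.El → Set σ.El) (z : U.Star ρ) :
    U.ext (U.map (τ := .pow σ) (fun a => V a ∪ W a) z) =
      U.ext (U.map (τ := .pow σ) V z) ∪ U.ext (U.map (τ := .pow σ) W z) := by
  ext x
  simp only [Set.mem_union, mem_ext_map]
  exact holds_or

theorem ext_star_empty : U.ext (U.star (σ := .pow σ) (∅ : Set σ.El)) = ∅ := by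
  refine Set.eq_empty_of_forall_notMem fun x hx => ?_
  rw [← map_const (τ := .pow σ) _ x, mem_ext_map] at hx
  exact holds_const.1 hx

theorem ext_map_subset_iff {V W : ρ.El → Set σ.El} {z : U.Star ρ} :
    U.ext (U.map (τ := .pow σ) V z) ⊆ U.ext (U.map (τ := .pow σ) W z) ↔
      U.Holds z (fun a => V a ⊆ W a) := by
  refine (forall₂_congr fun x _ => ?_).trans (holds_forall_mem (P := fun a b => b ∈ W a)).symm
  exact mem_ext_map

theorem rel_ncard_le_of_injOn {S : U.Star (.pow σ)} {Z : U.Star (.pow τ)}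
    {F : U.Star σ → U.Star τ} (hF : InternalFun F) (hmaps : Set.MapsTo F (U.ext S) (U.ext Z))
    (hinj : Set.InjOn F (U.ext S)) (hZ : U.Holds (σ := .pow τ) Z Set.Finite) :
    U.Rel (ρ := .pow τ) (σ := .pow σ) (fun Z S => S.Finite ∧ S.ncard ≤ Z.ncard) Z S := by
  obtain ⟨ρ, z, f, rfl⟩ := hF
  obtain ⟨w, rfl, rfl, rfl⟩ := exists_joint₃ z S Z
  rw [app_map_left] at hmaps hinj
  rw [rel_map]
  exact (mapsTo_app_iff.1 hmaps).mono₃ (injOn_app_iff.1 hinj) (holds_map.1 hZ)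
    fun p hm hi hfin => ⟨Set.Finite.of_injOn hm hi hfin, Set.ncard_le_ncard_of_injOn _ hm hi hfin⟩

theorem exists_ext_eq_biUnion {ι : Type*} {T : ι → U.Star (.pow σ)} {Z : U.Star (.pow τ)}
    (hT : ∀ i, U.Rel (ρ := .pow τ) (σ := .pow σ) (fun Z T => T.Finite ∧ T.ncard ≤ Z.ncard) Z (T i))
    (s : Finset ι) : ∃ S, U.ext S = ⋃ i ∈ s, U.ext (T i) ∧
      U.Rel (ρ := .pow τ) (σ := .pow σ) (fun Z S => S.Finite ∧ S.ncard ≤ s.card * Z.ncard) Z S := by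
  classical
  induction s using Finset.induction_on with
  | empty =>
    refine ⟨U.star (σ := .pow σ) ∅, by simp [ext_star_empty], ?_⟩
    rw [← map_const (τ := .pow σ) _ Z, ← U.map_id Z, map_map, rel_map]
    exact holds_of_forall fun _ => ⟨Set.finite_empty, by simp⟩
  | insert i s hi ih =>
    obtain ⟨S, hS, hcard⟩ := ih
    have hTi := hT i
    rw [Finset.set_biUnion_insert, ← hS, Finset.card_insert_of_notMem hi]
    generalize T i = T' at hTi
    obtain ⟨w, rfl, rfl, rfl⟩ := exists_joint₃ Z S T'
    rw [← ext_map_union]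
    refine ⟨_, rfl, ?_⟩
    rw [rel_map] at hcard hTi ⊢
    refine hcard.mono₂ hTi fun p h h' => ⟨h'.1.union h.1, (Set.ncard_union_le _ _).trans ?_⟩
    rw [Nat.succ_mul, add_comm]
    exact Nat.add_le_add h.2 h'.2

theorem not_cdLe_ext_of_ncard_mul_lt {S : U.Star (.pow σ)} {Z : U.Star (.pow τ)}
    (hZ : U.Holds (σ := .pow τ) Z Set.Finite)
    (hcard : ∀ m, U.Rel (ρ := .pow τ) (σ := .pow σ) (fun Z S => m * Z.ncard < S.ncard) Z S) :
    ¬ U.CDLe (U.ext S) (U.ext Z) := by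
  rintro ⟨θ, hmaps, hinj, hgraph⟩
  obtain ⟨ι, _, F, E, hF, hE, hFE, hcover⟩ := exists_internalFun_of_isCD_graph hinj hgraph
  choose T hT using fun i => (hE i).inter ((isInternal_ext Z).preimage (hF i))
  have hTcard : ∀ i, U.Rel (ρ := .pow τ) (σ := .pow σ)
      (fun Z T => T.Finite ∧ T.ncard ≤ Z.ncard) Z (T i) := fun i =>
    rel_ncard_le_of_injOn (hF i) (fun x hx => (hT i ▸ hx).2)
      ((hFE i).mono fun x hx => (hT i ▸ hx).1) hZ
  have hSub : U.ext S ⊆ ⋃ i, U.ext (T i) := fun x hx => by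
    obtain ⟨i, hxi, hi⟩ := hcover x hx
    have hθx := hmaps hx
    rw [hi] at hθx
    exact Set.mem_iUnion.2 ⟨i, (hT i).symm ▸ ⟨hxi, hθx⟩⟩
  obtain ⟨s, hs⟩ := exists_subset_biUnion_of_subset_iUnion (isInternal_ext S)
    (fun i => isInternal_ext (T i)) hSub
  obtain ⟨V, hV, hVcard⟩ := exists_ext_eq_biUnion hTcard s
  have hSV : U.ext S ⊆ U.ext V := hV ▸ hs
  have hScard := hcard s.card
  obtain ⟨w, rfl, rfl, rfl⟩ := exists_joint₃ Z S V
  have hsubset := (ext_map_subset_iff).1 hSV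
  rw [rel_map] at hVcard hScard
  refine holds_const.1 (hVcard.mono₃ hScard hsubset fun p hV hS hSV => ?_)
  exact (hS.trans_le (Set.ncard_le_ncard hSV hV.1)).not_ge hV.2

/-! ### The cuts `cℕ` and `c/ℕ`, and internal sets of infinitesimal measure -/

/-- The relation `*P(d, y)` between hyperintegers. Unlike `Rel` it leaves no types to be inferred:
unification cannot recover `StdType.nat` from `ℕ`. -/
abbrev NatRel (U : NonstandardUniverse.{u}) (P : ℕ → ℕ → Prop) (d y : U.Star .nat) : Prop :=
  U.Rel (ρ := .nat) (σ := .nat) P d y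

theorem hlt_map {f g : σ.El → ℕ} {w : U.Star σ} :
    U.hlt (U.map (τ := .nat) f w) (U.map (τ := .nat) g w) ↔ U.Holds w (fun a => f a < g a) :=
  rel_map (ρ := .nat) (τ := .nat) (P := fun a b : ℕ => a < b)

theorem hnat_eq_map (n : ℕ) (w : U.Star σ) :
    U.hnat n = U.map (τ := .nat) (fun _ => n) w :=
  (map_const (τ := .nat) n w).symm

theorem mem_divCut_htwoPow {d y : U.Star .nat} :
    y ∈ U.divCut (U.htwoPow d) ↔ ∀ n, U.NatRel (fun d y => y * n < 2 ^ d) d y := by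
  refine forall_congr' fun n => ?_
  obtain ⟨w, rfl, rfl⟩ := exists_joint (σ := .nat) (τ := .nat) d y
  rw [hmul, htwoPow, hnat_eq_map n w, pair_map, map_map (τ := .prod .nat .nat), map_map (τ := .nat),
    hlt_map, NatRel, rel_map]

theorem mem_mulCut_htwoPow {d y : U.Star .nat} :
    y ∈ U.mulCut (U.htwoPow d) ↔ ∃ n, U.NatRel (fun d y => y < 2 ^ d * n) d y := by
  refine exists_congr fun n => ?_
  obtain ⟨w, rfl, rfl⟩ := exists_joint (σ := .nat) (τ := .nat) d y
  rw [hmul, htwoPow, hnat_eq_map n w, map_map (τ := .nat), pair_map, map_map (τ := .prod .nat .nat),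
    hlt_map, NatRel, rel_map]

/-- `d` exceeds every standard natural number. -/
def IsInfinite (U : NonstandardUniverse.{u}) (d : U.Star .nat) : Prop :=
  ∀ n : ℕ, U.Holds (σ := .nat) d (fun d : ℕ => n < d)

theorem isInfinite_of_htwoPow_ne {d : U.Star .nat} (h : ∀ n, U.htwoPow d ≠ U.hnat n) :
    U.IsInfinite d := by
  have hne : ∀ n : ℕ, ¬ U.Holds (σ := .nat) d (fun d : ℕ => d = n) := fun n hn => by
    refine h (2 ^ n) ?_
    rw [htwoPow, hnat_eq_map _ d, ← holds_eq]
    exact hn.mono fun a (ha : a = n) => ha ▸ rfl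
  intro n
  induction n with
  | zero => exact (holds_not.2 (hne 0)).mono fun (a : ℕ) ha => Nat.pos_of_ne_zero ha
  | succ n ih =>
    exact ih.mono₂ (holds_not.2 (hne (n + 1))) fun (a : ℕ) hlt hne =>
      lt_of_le_of_ne hlt (Ne.symm hne)

/-- The internal set `Z` is finite in the internal sense and `|Z| / 2 ^ d` is infinitesimal. -/
def IsSmall (U : NonstandardUniverse.{u}) (d : U.Star .nat) (Z : U.Star (.pow σ)) : Prop :=
  ∀ m : ℕ, U.Rel (ρ := .nat) (σ := .pow σ)
    (fun (d : ℕ) (Z : Set σ.El) => Z.Finite ∧ Z.ncard * m ≤ 2 ^ d) d Z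

theorem isSmall_star_empty {d : U.Star .nat} : U.IsSmall d (U.star (σ := .pow σ) ∅) := fun m => by
  rw [← map_const (τ := .pow σ) _ d, ← U.map_id d, map_map, rel_map]
  exact holds_of_forall fun _ => ⟨Set.finite_empty, by simp⟩

theorem isSmall_map {δ : ρ.El → ℕ} {V : ρ.El → Set σ.El} {z : U.Star ρ} :
    U.IsSmall (U.map (τ := .nat) δ z) (U.map (τ := .pow σ) V z) ↔
      ∀ m : ℕ, U.Holds z (fun a => (V a).Finite ∧ (V a).ncard * m ≤ 2 ^ δ a) :=
  forall_congr' fun _ => rel_map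

theorem IsSmall.exists_union {d : U.Star .nat} {Z Z' : U.Star (.pow σ)} (hZ : U.IsSmall d Z)
    (hZ' : U.IsSmall d Z') : ∃ Y, U.IsSmall d Y ∧ U.ext Y = U.ext Z ∪ U.ext Z' := by
  obtain ⟨w, rfl, rfl, rfl⟩ := exists_joint₃ d Z Z'
  refine ⟨_, ?_, ext_map_union _ _ _⟩
  rw [isSmall_map] at hZ hZ' ⊢
  intro m
  refine (hZ (2 * m)).mono₂ (hZ' (2 * m)) fun p h h' => ⟨h.1.union h'.1, ?_⟩
  have hunion := Nat.mul_le_mul_right m (Set.ncard_union_le p.2.1 p.2.2)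
  linarith [h.2, h'.2]

variable (U) in
/-- `X` is covered by an internal set of infinitesimal measure. -/
def IsNegligible (d : U.Star .nat) (X : Set (U.Star σ)) : Prop :=
  ∃ Z, U.IsSmall d Z ∧ X ⊆ U.ext Z

theorem isNegligible_iUnion {ι : Type*} [Countable ι] {d : U.Star .nat}
    {X : ι → Set (U.Star σ)} (hX : ∀ i, U.IsNegligible d (X i)) :
    U.IsNegligible d (⋃ i, X i) := by
  classical
  choose T hT hXT using hX
  have hfin : ∀ s : Finset ι, ∃ Z, U.IsSmall d Z ∧ ∀ i ∈ s, U.ext (T i) ⊆ U.ext Z := fun s => by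
    induction s using Finset.induction_on with
    | empty => exact ⟨_, isSmall_star_empty, by simp⟩
    | insert i s _ ih =>
      obtain ⟨Z, hZ, hsub⟩ := ih
      obtain ⟨Y, hY, hext⟩ := (hT i).exists_union hZ
      refine ⟨Y, hY, fun j hj => hext ▸ ?_⟩
      obtain rfl | hj := Finset.mem_insert.1 hj
      exacts [Set.subset_union_left, (hsub j hj).trans Set.subset_union_right]
  have hint : ∀ o : (ι ⊕ ℕ), U.IsInternal (o.elim (fun i => {Z | U.ext (T i) ⊆ U.ext Z}) fun m =>
      {Z | U.Rel (ρ := .nat) (σ := .pow σ) (fun d Z => Z.Finite ∧ Z.ncard * m ≤ 2 ^ d) d Z}) := by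
    rintro (i | m)
    · convert isInternal_rel (ρ := .pow σ) (σ := .pow σ) (fun T Z => T ⊆ Z) (T i) using 1
      ext Z
      obtain ⟨w, hT, rfl⟩ := exists_joint (T i) Z
      simp only [Set.mem_ofPred, Sum.elim_inl, ← hT, ext_map_subset_iff, rel_map]
    · exact isInternal_rel (ρ := .nat) (σ := .pow σ)
        (fun (d : ℕ) (Z : Set σ.El) => Z.Finite ∧ Z.ncard * m ≤ 2 ^ d) d
  obtain ⟨Z, hZ⟩ := exists_forall_mem hint fun s => by
    obtain ⟨Z, hZ, hsub⟩ := hfin s.toLeft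
    refine ⟨Z, ?_⟩
    rintro (i | m) hi
    exacts [hsub i (Finset.mem_toLeft.2 hi), hZ m]
  exact ⟨Z, fun m => hZ (.inr m), Set.iUnion_subset fun i => (hXT i).trans (hZ (.inl i))⟩

theorem mul_add_one_mul_lt_two_pow {n k m d : ℕ} (hm : m ≤ n) (hn : 2 * n < d)
    (hk : k * (2 * n * n) ≤ 2 ^ d) : (n * k + 1) * m < 2 ^ d := by
  have hpow : d < 2 ^ d := Nat.lt_two_pow_self
  have hle := Nat.mul_le_mul_left (n * k + 1) hm
  linarith

theorem IsSmall.exists_subset_divCut {d : U.Star .nat} (hd : U.IsInfinite d)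
    {Z : U.Star (.pow σ)} (hZ : U.IsSmall d Z) :
    ∃ S : U.Star (.pow .nat), U.ext S ⊆ U.divCut (U.htwoPow d) ∧ ∀ m, U.Rel (ρ := .pow σ)
      (σ := .pow .nat) (fun (Z : Set σ.El) (S : Set ℕ) => m * Z.ncard < S.ncard) Z S := by
  obtain ⟨v, rfl, rfl⟩ := exists_joint d Z
  rw [isSmall_map] at hZ
  have hd' : ∀ n : ℕ, U.Holds (σ := .prod .nat (.pow σ)) v fun p => n < p.1 :=
    fun n => holds_map.1 (hd n)
  obtain ⟨a, ha⟩ := exists_forall_rel (ρ := .prod .nat (.pow σ)) (σ := .nat) (z := v)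
    (P := fun m p a => m * p.2.ncard < a ∧ a * m < 2 ^ p.1) fun n => by
      refine (hZ (2 * n * n)).mono₂ (hd' (2 * n)) fun p hp hn =>
        ⟨n * p.2.ncard + 1, fun m hm => ⟨?_, ?_⟩⟩
      · exact Nat.lt_succ_of_le (Nat.mul_le_mul_right _ hm.le)
      · exact mul_add_one_mul_lt_two_pow hm.le hn hp.2
  refine ⟨U.map (σ := .nat) (τ := .pow .nat) (fun a : ℕ => Set.Iio a) a, fun y hy => ?_,
    fun m => ?_⟩
  · rw [mem_divCut_htwoPow]
    intro n
    have han := ha n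
    obtain ⟨w, rfl, rfl, rfl⟩ := exists_joint₃ (τ := .nat) (ρ := .nat) v a y
    rw [mem_ext_map (ρ := .nat), rel_map] at hy
    rw [rel_map] at han
    rw [map_map (τ := .prod .nat (.pow σ)), NatRel, rel_map]
    exact han.mono₂ hy fun p hp hlt =>
      (Nat.mul_le_mul_right n (Set.mem_Iio.1 hlt).le).trans_lt hp.2
  · have ham := ha m
    obtain ⟨w, rfl, rfl⟩ := exists_joint (τ := .nat) v a
    rw [rel_map] at ham
    rw [map_map (τ := .prod .nat (.pow σ)), map_map (τ := .nat), rel_map]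
    exact ham.mono fun p hp => by simpa only [Set.ncard_Iio_nat] using hp.1

theorem not_cdLe_divCut_of_isSmall {d : U.Star .nat} (hd : U.IsInfinite d) {Z : U.Star (.pow σ)}
    (hZ : U.IsSmall d Z) : ¬ U.CDLe (U.divCut (U.htwoPow d)) (U.ext Z) := by
  obtain ⟨S, hS, hcard⟩ := hZ.exists_subset_divCut hd
  have hfin : U.Holds (σ := .pow σ) Z Set.Finite := holds_pair_snd.1 ((hZ 0).mono fun p hp => hp.1)
  exact fun h => not_cdLe_ext_of_ncard_mul_lt hfin hcard
    ((CDLe.of_subset (isInternal_ext S).isCD hS).trans h)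

/-! ### Internal functions and codes obtained by saturation -/

theorem exists_injOn_eqOn_of_ncard_le {α β : Type*} {A V : Set α} {W : Set β} {f : α → β}
    (hV : V.Finite) (hW : W.Finite) (hAV : A ⊆ V) (hcard : V.ncard ≤ W.ncard)
    (hinj : Set.InjOn f A) (hmaps : Set.MapsTo f A W) :
    ∃ g, Set.EqOn g f A ∧ Set.InjOn g V ∧ Set.MapsTo g V W := by
  classical
  obtain ⟨y⟩ | hβ := isEmpty_or_nonempty β |>.symm
  swap
  · exact ⟨f, fun _ _ => rfl, fun x => (hβ.false (f x)).elim, fun x => (hβ.false (f x)).elim⟩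
  have hA : A.Finite := hV.subset hAV
  have hrest : (V \ A).encard ≤ (W \ f '' A).encard := by
    rw [← (hV.sdiff).cast_ncard_eq, ← (hW.sdiff).cast_ncard_eq, Set.ncard_sdiff hAV hA,
      Set.ncard_sdiff hmaps.image_subset (hA.image f), hinj.ncard_image]
    exact_mod_cast Nat.sub_le_sub_right hcard _
  obtain ⟨h, hh, hhinj⟩ := hV.sdiff.exists_injOn_of_encard_le hrest
  have hgf : Set.EqOn (A.piecewise f h) f A := Set.piecewise_eqOn A f h
  have hgh : Set.EqOn (A.piecewise f h) h (V \ A) :=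
    (Set.piecewise_eqOn_compl A f h).mono fun x hx => hx.2
  refine ⟨A.piecewise f h, hgf, ?_, ?_⟩
  · rw [← Set.union_sdiff_cancel hAV, Set.injOn_union Set.disjoint_sdiff_right]
    refine ⟨hinj.congr hgf.symm, hhinj.congr hgh.symm, fun x hx y hy hxy => ?_⟩
    rw [hgf hx, hgh hy] at hxy
    exact (hh hy).2 ⟨x, hx, hxy⟩
  · rw [← Set.union_sdiff_cancel hAV]
    exact (hmaps.congr hgf.symm).union_union ((show Set.MapsTo h (V \ A) W from fun x hx =>
      (hh hx).1).congr hgh.symm) |>.mono_right (Set.union_self W).subset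

theorem exists_injOn_mapsTo_chain {α β : Type*} {V : ℕ → Set α} {W : ℕ → Set β} {K : ℕ}
    [Nonempty β] (hV : (V 0).Finite) (hW : (W 0).Finite) (hVanti : ∀ k < K, V (k + 1) ⊆ V k)
    (hWanti : ∀ k < K, W (k + 1) ⊆ W k) (hcard : ∀ k ≤ K, (V k).ncard ≤ (W k).ncard) :
    ∃ f : α → β, Set.InjOn f (V 0) ∧ ∀ k ≤ K, Set.MapsTo f (V k) (W k) := by
  induction K generalizing V W with
  | zero =>
    obtain ⟨f, -, hinj, hmaps⟩ := exists_injOn_eqOn_of_ncard_le hV hW (Set.empty_subset _)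
      (hcard 0 le_rfl) (f := fun _ => Classical.arbitrary β) (Set.injOn_empty _)
      (Set.mapsTo_empty _ _)
    exact ⟨f, hinj, fun k hk => Nat.le_zero.1 hk ▸ hmaps⟩
  | succ K ih =>
    have hV1 := hVanti 0 K.succ_pos
    have hW1 := hWanti 0 K.succ_pos
    obtain ⟨f, hinj, hmaps⟩ := ih (V := fun k => V (k + 1)) (W := fun k => W (k + 1))
      (hV.subset hV1) (hW.subset hW1) (fun k hk => hVanti _ (Nat.succ_lt_succ hk))
      (fun k hk => hWanti _ (Nat.succ_lt_succ hk)) fun k hk => hcard _ (Nat.succ_le_succ hk)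
    obtain ⟨g, hgf, hginj, hg⟩ := exists_injOn_eqOn_of_ncard_le hV hW hV1 (hcard 0 (Nat.zero_le _))
      hinj ((hmaps 0 (Nat.zero_le _)).mono_right hW1)
    have hsub : ∀ k ≤ K, V (k + 1) ⊆ V 1 := fun k hk => by
      induction k with
      | zero => rfl
      | succ k ihk => exact (hVanti _ (Nat.succ_le_succ hk)).trans (ihk (Nat.le_of_succ_le hk))
    refine ⟨g, hginj, fun k hk => ?_⟩
    cases k with
    | zero => exact hg
    | succ k =>
      have hkK := Nat.le_of_succ_le_succ hk
      exact (hmaps k hkK).congr (hgf.symm.mono (hsub k hkK))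

theorem exists_internalFun_injOn_mapsTo {z : U.Star ρ} {V : ℕ → ρ.El → Set σ.El}
    {W : ℕ → ρ.El → Set τ.El}
    (h : ∀ K, U.Holds z fun a => ∃ f : σ.El → τ.El, Set.InjOn f (V 0 a) ∧
      ∀ k ≤ K, Set.MapsTo f (V k a) (W k a)) :
    ∃ F : U.Star σ → U.Star τ, InternalFun F ∧ Set.InjOn F (U.ext (U.map (τ := .pow σ) (V 0) z)) ∧
      ∀ k, Set.MapsTo F (U.ext (U.map (τ := .pow σ) (V k) z))
        (U.ext (U.map (τ := .pow τ) (W k) z)) := by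
  obtain ⟨S, hS⟩ := exists_forall_rel (U := U) (σ := .pow (.prod σ τ)) (z := z)
    (P := fun k a (S : Set (σ.El × τ.El)) =>
      Set.InjOn (selector S) (V 0 a) ∧ Set.MapsTo (selector S) (V k a) (W k a))
    fun n => (h n).mono fun a ⟨f, hinj, hmaps⟩ => ⟨{p | f p.1 = p.2}, fun m hm => by
      rw [selector_graph]
      exact ⟨hinj, hmaps m hm.le⟩⟩
  obtain ⟨w, rfl, rfl⟩ := exists_joint (τ := .pow (.prod σ τ)) z S
  refine ⟨app selector (U.map (σ := .prod ρ (.pow (.prod σ τ))) (fun p => p.2) w),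
    internalFun_app _ _, ?_⟩
  simp only [app_map_left, map_map, injOn_app_iff, mapsTo_app_iff]
  exact ⟨(rel_map.1 (hS 0)).mono fun p hp => hp.1,
    fun k => (rel_map.1 (hS k)).mono fun p hp => hp.2⟩

theorem pair_hnat_mem_ext_iff {H : U.Star (.pow (.prod .nat σ))} {m : ℕ} {x : U.Star σ} :
    U.pair (U.hnat m) x ∈ U.ext H ↔
      U.Rel (ρ := .pow (.prod .nat σ)) (fun H b => (m, b) ∈ H) H x := by
  obtain ⟨w, rfl, rfl⟩ := exists_joint (σ := .pow (.prod .nat σ)) H x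
  rw [hnat_eq_map m w, pair_map, mem_ext_iff, rel_map, rel_map]

theorem hnat_inj {m n : ℕ} : U.hnat m = U.hnat n ↔ m = n := by
  have w := U.star (σ := .nat) 0
  rw [hnat_eq_map m w, hnat_eq_map n w, ← holds_eq (τ := .nat), holds_const]

theorem internalFun_const (y : U.Star τ) : InternalFun (fun _ : U.Star σ => y) := by
  refine ⟨τ, y, fun a _ => a, funext fun x => ?_⟩
  rw [app, map_fst]

theorem ext_injective : Function.Injective (U.ext (σ := σ)) := fun S T h => by
  obtain ⟨w, rfl, rfl⟩ := exists_joint (σ := .pow σ) (τ := .pow σ) S T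
  rw [← holds_eq (τ := .pow σ)]
  exact (ext_map_subset_iff.1 h.subset).mono₂ (ext_map_subset_iff.1 h.superset)
    fun p => Set.Subset.antisymm

theorem exists_map_section_eq (S : ℕ → U.Star (.pow σ)) : ∃ H : U.Star (.pow (.prod .nat σ)),
    ∀ m, U.map (σ := .pow (.prod .nat σ)) (τ := .pow σ) (fun H => {b | (m, b) ∈ H}) H = S m := by
  have hsection : ∀ (m : ℕ) (S : U.Star (.pow σ)) (H : U.Star (.pow (.prod .nat σ))),
      U.map (σ := .pow (.prod .nat σ)) (τ := .pow σ) (fun H => {b | (m, b) ∈ H}) H = S ↔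
        ∀ x, U.pair (U.hnat m) x ∈ U.ext H ↔ x ∈ U.ext S := fun m S H => by
    rw [← ext_injective.eq_iff, Set.ext_iff]
    exact forall_congr' fun x => by
      rw [pair_hnat_mem_ext_iff, mem_ext_map (ρ := .pow _)]
      exact Iff.rfl
  simp only [hsection]
  refine exists_forall_mem (A := fun m => {H | ∀ x, U.pair (U.hnat m) x ∈ U.ext H ↔
    x ∈ U.ext (S m)}) (fun m => ?_) fun s => ?_
  · simp only [← hsection]
    exact (internalFun_map _).isInternal_eq (internalFun_const _)
  · obtain ⟨n, hn⟩ := s.exists_nat_subset_range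
    obtain ⟨H, hH⟩ := IsInternal.forall_lt (U := U) (σ := .prod .nat σ)
      (A := fun m => ({q | U.map Prod.fst q = U.hnat m} ∩ U.map Prod.snd ⁻¹' (U.ext (S m))ᶜ)ᶜ)
      (fun m => ((internalFun_fst.isInternal_eq (internalFun_const _)).inter
        ((isInternal_ext (S m)).compl.preimage internalFun_snd)).compl) n
    refine ⟨H, fun m hm x => ?_⟩
    have hmn := Finset.mem_range.1 (hn hm)
    simp only [hH, Set.mem_ofPred, Set.mem_compl_iff, Set.mem_inter_iff, Set.mem_preimage,
      U.map_fst_pair, U.map_snd_pair, hnat_inj, not_and, not_not]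
    exact ⟨fun h => h m hmn rfl, fun hx k _ hmk => hmk ▸ hx⟩

theorem exists_internalFun_injOn_mapsTo_of_ncard_le {V : ℕ → U.Star (.pow σ)}
    {W : ℕ → U.Star (.pow τ)} (hV : Antitone fun k => U.ext (V k))
    (hW : Antitone fun k => U.ext (W k))
    (hcard : ∀ k, U.Rel (ρ := .pow σ) (σ := .pow τ)
      (fun V W => V.Finite ∧ W.Finite ∧ V.ncard ≤ W.ncard) (V k) (W k)) :
    ∃ F : U.Star σ → U.Star τ, InternalFun F ∧ Set.InjOn F (U.ext (V 0)) ∧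
      ∀ k, Set.MapsTo F (U.ext (V k)) (U.ext (W k)) := by
  obtain ⟨H, hH⟩ := exists_map_section_eq V
  obtain ⟨H', hH'⟩ := exists_map_section_eq W
  obtain ⟨w, rfl, rfl⟩ := exists_joint H H'
  simp only [map_map (τ := .pow _)] at hH hH'
  simp only [← hH, ← hH'] at hV hW hcard ⊢
  refine exists_internalFun_injOn_mapsTo (U := U)
    (ρ := .prod (.pow (.prod .nat σ)) (.pow (.prod .nat τ))) (z := w)
    (V := fun k a => {b | (k, b) ∈ a.1}) (W := fun k a => {b | (k, b) ∈ a.2}) fun K => ?_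
  have hlt : ∀ P : ℕ → _ → Prop, (∀ k, U.Holds w (P k)) → U.Holds w fun a => ∀ k < K + 1, P k a :=
    fun P hP => holds_forall_lt.2 fun k _ => hP k
  refine (hlt _ fun k => ext_map_subset_iff.1 (hV k.le_succ)).mono₃
    (hlt _ fun k => ext_map_subset_iff.1 (hW k.le_succ)) (hlt _ fun k => rel_map.1 (hcard k))
    fun a hVa hWa hca => ?_
  exact exists_injOn_mapsTo_chain (hca 0 K.succ_pos).1 (hca 0 K.succ_pos).2.1
    (fun k hk => hVa k (hk.trans K.lt_succ_self)) (fun k hk => hWa k (hk.trans K.lt_succ_self))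
    fun k hk => (hca k (Nat.lt_succ_of_le hk)).2.2

/-! ### Binary digits and monads -/

variable (U) in
/-- The hyperfinite interval `[0, 2 ^ d)`. -/
def segment (d : U.Star .nat) : Set (U.Star .nat) :=
  {y | U.NatRel (fun d y => y < 2 ^ d) d y}

theorem isInternal_segment (d : U.Star .nat) : U.IsInternal (U.segment d) :=
  isInternal_rel _ _

variable (U) in
open Classical in
/-- The sequence of the binary digits of `y < 2 ^ d` at the standard places, counted from the
leading one. -/
noncomputable def leadingDigits (d y : U.Star .nat) (k : ℕ) : Fin 2 :=
  if U.NatRel (fun d y => y / 2 ^ (d - (k + 1)) % 2 = 1) d y then 1 else 0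

theorem leadingDigits_eq_iff {d y : U.Star .nat} {k : ℕ} {v : Fin 2} :
    U.leadingDigits d y k = v ↔ U.NatRel (fun d y => y / 2 ^ (d - (k + 1)) % 2 = v) d y := by
  fin_cases v
  · have hzero : U.NatRel (fun d y => y / 2 ^ (d - (k + 1)) % 2 = 0) d y ↔
        ¬ U.NatRel (fun d y => y / 2 ^ (d - (k + 1)) % 2 = 1) d y :=
      (holds_congr fun p => Nat.mod_two_ne_one.symm).trans holds_not
    simpa [leadingDigits] using hzero.symm
  · simp [leadingDigits]

variable (U) in
/-- The monad of `g` in `[0, 2 ^ d)`: the numbers whose leading binary digits are given by `g`. -/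
def digitMonad (d : U.Star .nat) (g : ℕ → Fin 2) : Set (U.Star .nat) :=
  {y ∈ U.segment d | U.leadingDigits d y = g}

variable (U) in
/-- The union of the monads of the sequences in `G`. It is the counterpart in `[0, 2 ^ d)` of the
set `M^d_G` of internal binary sequences. -/
def digitMonadUnion (d : U.Star .nat) (G : Set (ℕ → Fin 2)) : Set (U.Star .nat) :=
  {y ∈ U.segment d | U.leadingDigits d y ∈ G}

theorem isCD_leadingDigits_preimage (d : U.Star .nat) (G : Set (ℕ → Fin 2)) :
    U.IsCD (U.leadingDigits d ⁻¹' G) := by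
  classical
  convert isCD_of_isInternal (U := U) (σ := .nat)
    (fun k => isInternal_rel (U := U) (ρ := .nat) (σ := .nat)
      (fun d y => y / 2 ^ (d - (k + 1)) % 2 = 1) d)
    (fun K => (fun k => if k ∈ K then (1 : Fin 2) else 0) ∈ G) using 1
  ext y
  exact iff_of_eq (congrArg (· ∈ G) (funext fun k => by unfold leadingDigits; congr))

theorem isCD_digitMonadUnion (d : U.Star .nat) (G : Set (ℕ → Fin 2)) :
    U.IsCD (U.digitMonadUnion d G) :=
  (isInternal_segment d).isCD.inter (isCD_leadingDigits_preimage d G)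

theorem isCD_digitMonad (d : U.Star .nat) (g : ℕ → Fin 2) : U.IsCD (U.digitMonad d g) :=
  isCD_digitMonadUnion d {g}

/-- The number with the binary digits `g 0, …, g (k - 1)`, the leading digit first. -/
def prefixNum (g : ℕ → Fin 2) : ℕ → ℕ
  | 0 => 0
  | k + 1 => 2 * prefixNum g k + g k

theorem prefixNum_congr {g h : ℕ → Fin 2} {k : ℕ} (hgh : ∀ i < k, g i = h i) :
    prefixNum g k = prefixNum h k := by
  induction k with
  | zero => rfl
  | succ k ih =>
    rw [prefixNum, prefixNum, ih fun i hi => hgh i (hi.trans k.lt_succ_self), hgh k k.lt_succ_self]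

theorem prefixNum_succ_div_two (g : ℕ → Fin 2) (k : ℕ) :
    prefixNum g (k + 1) / 2 = prefixNum g k := by
  rw [prefixNum, Nat.mul_add_div two_pos, Nat.div_eq_of_lt (g k).2, add_zero]

theorem div_two_pow_sub_succ_div_two {d k : ℕ} (h : k < d) (y : ℕ) :
    y / 2 ^ (d - (k + 1)) / 2 = y / 2 ^ (d - k) := by
  rw [Nat.div_div_eq_div_mul, ← pow_succ, Nat.sub_add_eq, Nat.sub_add_cancel (Nat.sub_pos_of_lt h)]

variable (U) in
/-- The code of the internal set of all numbers whose first `k` out of `d` binary digits are those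
of `t`. -/
def digitBlock (d : U.Star .nat) (k t : ℕ) : U.Star (.pow .nat) :=
  U.map (σ := .nat) (τ := .pow .nat) (fun (d : ℕ) => {y : ℕ | y / 2 ^ (d - k) = t}) d

theorem mem_ext_digitBlock {d y : U.Star .nat} {k t : ℕ} :
    y ∈ U.ext (U.digitBlock d k t) ↔ U.NatRel (fun d y => y / 2 ^ (d - k) = t) d y :=
  mem_ext_map

theorem antitone_ext_digitBlock {d : U.Star .nat} (hd : U.IsInfinite d) (g : ℕ → Fin 2) :
    Antitone fun k => U.ext (U.digitBlock d k (prefixNum g k)) := by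
  refine antitone_nat_of_succ_le fun k y hy => ?_
  rw [mem_ext_digitBlock] at hy ⊢
  refine hy.mono₂ (holds_pair_fst.2 (hd k)) fun p hp hk => ?_
  exact (div_two_pow_sub_succ_div_two hk _).symm.trans (hp ▸ prefixNum_succ_div_two g k)

theorem digitMonad_eq_iInter {d : U.Star .nat} (hd : U.IsInfinite d) (g : ℕ → Fin 2) :
    U.digitMonad d g = ⋂ k, U.ext (U.digitBlock d k (prefixNum g k)) := by
  ext y
  simp only [digitMonad, Set.mem_ofPred, funext_iff, leadingDigits_eq_iff, Set.mem_iInter,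
    mem_ext_digitBlock]
  constructor
  · rintro ⟨hy, hg⟩ k
    induction k with
    | zero => exact hy.mono fun p hp => Nat.div_eq_of_lt hp
    | succ k ih =>
      refine ih.mono₃ (hg k) (holds_pair_fst.2 (hd k)) fun p h₁ h₂ h₃ => ?_
      rw [prefixNum, ← h₁, ← h₂, ← div_two_pow_sub_succ_div_two h₃]
      exact (Nat.div_add_mod _ 2).symm
  · refine fun h => ⟨(h 0).mono fun p hp => ?_, fun k => (h (k + 1)).mono fun p hp => ?_⟩
    · simpa [prefixNum] using hp
    · simp only at hp ⊢
      rw [hp, prefixNum, Nat.mul_add_mod]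
      exact Nat.mod_eq_of_lt (g k).2

theorem natRel_lt_of_mem_digitMonad {d y y' : U.Star .nat} (hd : U.IsInfinite d)
    {g g' : ℕ → Fin 2} {n : ℕ} (hy : y ∈ U.digitMonad d g) (hy' : y' ∈ U.digitMonad d g')
    (h : ∀ i < n, g i = g' i) (hn : g n < g' n) : U.NatRel (· < ·) y y' := by
  rw [digitMonad_eq_iInter hd] at hy hy'
  have hprefix := mem_ext_digitBlock.1 (Set.mem_iInter.1 hy (n + 1))
  have hprefix' := mem_ext_digitBlock.1 (Set.mem_iInter.1 hy' (n + 1))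
  obtain ⟨w, rfl, rfl, rfl⟩ := exists_joint₃ d y y'
  rw [NatRel, rel_map] at hprefix hprefix' ⊢
  refine hprefix.mono₂ hprefix' fun a ha ha' => lt_of_not_ge fun hle => ?_
  have hdiv := Nat.div_le_div_right (c := 2 ^ (a.1 - (n + 1))) hle
  rw [ha, ha', prefixNum, prefixNum, prefixNum_congr h] at hdiv
  exact absurd (Nat.le_of_add_le_add_left hdiv) (not_le_of_gt hn)

theorem setOf_div_two_pow_eq (n t : ℕ) :
    {y : ℕ | y / 2 ^ n = t} = Set.Ico (t * 2 ^ n) ((t + 1) * 2 ^ n) := by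
  ext y
  have h : 0 < 2 ^ n := Nat.two_pow_pos n
  rw [Set.mem_Ico, ← Nat.le_div_iff_mul_le h, ← Nat.div_lt_iff_lt_mul h, Nat.lt_succ_iff, and_comm,
    ← le_antisymm_iff, Set.mem_ofPred]

theorem finite_setOf_div_two_pow_eq (n t : ℕ) : {y : ℕ | y / 2 ^ n = t}.Finite :=
  setOf_div_two_pow_eq n t ▸ Set.finite_Ico _ _

theorem ncard_setOf_div_two_pow_eq (n t : ℕ) : {y : ℕ | y / 2 ^ n = t}.ncard = 2 ^ n := by
  rw [setOf_div_two_pow_eq, ← Finset.coe_Ico, Set.ncard_coe_finset, Nat.card_Ico, ← Nat.sub_mul,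
    Nat.add_sub_cancel_left, one_mul]

theorem segment_map {δ : ρ.El → ℕ} {z : U.Star ρ} :
    U.segment (U.map (τ := .nat) δ z) =
      U.ext (U.map (τ := .pow .nat) (fun a => Set.Iio (2 ^ δ a)) z) := by
  ext y
  rw [mem_ext_map (V := fun a => Set.Iio (2 ^ δ a)), segment, Set.mem_ofPred, NatRel, rel_map_left]
  exact Iff.rfl

theorem two_pow_sub_le_of_two_pow_le_mul {d s n n' : ℕ} (h : 2 ^ d ≤ s * n) (hn : n ≤ n')
    (hd : n' < d) : 2 ^ (d - n') ≤ s := by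
  refine Nat.le_of_mul_le_mul_right ?_ (Nat.two_pow_pos n')
  rw [← pow_add, Nat.sub_add_cancel hd.le]
  exact h.trans (Nat.mul_le_mul_left s (hn.trans Nat.lt_two_pow_self.le))

theorem exists_two_pow_le_ncard {d : U.Star .nat} (hd : U.IsInfinite d) {S : U.Star (.pow .nat)}
    (hS : U.ext S ⊆ U.segment d) (h : ¬ U.IsSmall d S) :
    ∃ n, ∀ n' ≥ n, U.Rel (ρ := .nat) (σ := .pow .nat)
      (fun (d : ℕ) (S : Set ℕ) => S.Finite ∧ 2 ^ (d - n') ≤ S.ncard) d S := by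
  obtain ⟨n, hn⟩ := not_forall.1 h
  refine ⟨n, fun n' hn' => ?_⟩
  have hd' := hd n'
  obtain ⟨w, rfl, rfl⟩ := exists_joint d S
  rw [segment_map, ext_map_subset_iff] at hS
  rw [rel_map, ← holds_not] at hn
  rw [holds_map] at hd'
  rw [rel_map]
  refine hn.mono₃ hS hd' fun p hp hsub hlt => ?_
  have hfin : Set.Finite p.2 := (Set.finite_Iio _).subset hsub
  exact ⟨hfin, two_pow_sub_le_of_two_pow_le_mul (le_of_not_ge fun hle => hp ⟨hfin, hle⟩) hn' hlt⟩

theorem exists_internalFun_digitMonad_mapsTo_iInter {d : U.Star .nat} (hd : U.IsInfinite d)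
    (g : ℕ → Fin 2) {W : ℕ → Set (U.Star .nat)} (hW : ∀ k, U.IsInternal (W k))
    (hanti : Antitone W) (hsub : ∀ k, W k ⊆ U.segment d)
    (hlarge : ∀ k, ¬ U.IsNegligible d (W k)) :
    ∃ F : U.Star .nat → U.Star .nat, InternalFun F ∧ Set.InjOn F (U.digitMonad d g) ∧
      Set.MapsTo F (U.digitMonad d g) (⋂ k, W k) := by
  choose S hS using hW
  obtain rfl : W = fun k => U.ext (S k) := funext fun k => (hS k).symm
  choose n hn using fun k => exists_two_pow_le_ncard hd (hsub k)
    fun h => hlarge k ⟨S k, h, subset_rfl⟩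
  let N : ℕ → ℕ := fun k => ∑ i ∈ Finset.range (k + 1), n i
  have hN : Monotone N := fun k k' h => Finset.sum_le_sum_of_subset (Finset.range_mono (by gcongr))
  have hnN : ∀ k, n k ≤ N k := fun k =>
    Finset.single_le_sum (fun _ _ => Nat.zero_le _) (Finset.self_mem_range_succ k)
  obtain ⟨F, hF, hinj, hmaps⟩ := exists_internalFun_injOn_mapsTo_of_ncard_le
    (V := fun k => U.digitBlock d (N k) (prefixNum g (N k))) (W := S)
    (fun k k' h => antitone_ext_digitBlock hd g (hN h)) hanti fun k => by
      rw [digitBlock, rel_map_left]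
      refine (hn k (N k) (hnN k)).mono fun p hp => ⟨finite_setOf_div_two_pow_eq _ _, hp.1, ?_⟩
      exact (ncard_setOf_div_two_pow_eq _ _).trans_le hp.2
  rw [digitMonad_eq_iInter hd]
  exact ⟨F, hF, hinj.mono (Set.iInter_subset _ _),
    fun y hy => Set.mem_iInter.2 fun k => hmaps k (Set.mem_iInter.1 hy _)⟩

theorem add_two_pow_sub_succ_le {d k s : ℕ} (hk : k < d) (hs : s * 2 ^ (k + 1) ≤ 2 ^ d) :
    s + 2 ^ (d - (k + 1)) ≤ 2 ^ (d - k) := by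
  have hsplit : 2 ^ (d - (k + 1)) * 2 ^ (k + 1) = 2 ^ d := by rw [← pow_add, Nat.sub_add_cancel hk]
  have hle : s ≤ 2 ^ (d - (k + 1)) :=
    Nat.le_of_mul_le_mul_right (hs.trans hsplit.ge) (Nat.two_pow_pos _)
  have hdouble : 2 ^ (d - k) = 2 * 2 ^ (d - (k + 1)) := by
    rw [← pow_succ', Nat.sub_add_eq, Nat.sub_add_cancel (Nat.sub_pos_of_lt hk)]
  linarith

theorem exists_internalFun_mapsTo_digitMonad {d : U.Star .nat} (hd : U.IsInfinite d)
    (g : ℕ → Fin 2) {Z : U.Star (.pow .nat)} (hZ : U.IsSmall d Z) :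
    ∃ F : U.Star .nat → U.Star .nat, InternalFun F ∧ Set.InjOn F (U.ext Z ∪ U.digitMonad d g) ∧
      Set.MapsTo F (U.ext Z ∪ U.digitMonad d g) (U.digitMonad d g) := by
  have hanti := antitone_ext_digitBlock hd g
  rw [digitMonad_eq_iInter hd]
  have hd' := hd
  obtain ⟨w, rfl, rfl⟩ := exists_joint d Z
  rw [isSmall_map] at hZ
  simp only [IsInfinite, holds_map] at hd'
  simp only [digitBlock, map_map (τ := .nat)] at hanti ⊢
  obtain ⟨F, hF, hinj, hmaps⟩ := exists_internalFun_injOn_mapsTo_of_ncard_le (U := U)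
    (V := fun k => U.map (σ := .prod .nat (.pow .nat)) (τ := .pow .nat)
      (fun p => p.2 ∪ {y : ℕ | y / 2 ^ (p.1 - (k + 1)) = prefixNum g (k + 1)}) w)
    (fun k k' h => by
      simp only [ext_map_union]
      exact Set.union_subset_union_right _ (hanti (by gcongr))) hanti fun k => by
        rw [rel_map]
        refine (hZ (2 ^ (k + 1))).mono₂ (hd' k) fun p hp hk =>
          ⟨hp.1.union (finite_setOf_div_two_pow_eq _ _), finite_setOf_div_two_pow_eq _ _, ?_⟩
        refine (Set.ncard_union_le _ _).trans ?_
        rw [ncard_setOf_div_two_pow_eq, ncard_setOf_div_two_pow_eq]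
        exact add_two_pow_sub_succ_le hk hp.2
  simp only [ext_map_union] at hinj hmaps
  exact ⟨F, hF, hinj.mono (Set.union_subset_union_right _ (Set.iInter_subset _ _)), fun y hy =>
    Set.mem_iInter.2 fun k =>
      hmaps k (Set.union_subset_union_right _ (Set.iInter_subset _ (k + 1)) hy)⟩

/-! ### Unions of monads and monotone signatures -/

theorem cdLe_of_fiberwise {ι : Type*} [Nonempty ι] {κ : U.Star σ → ι}
    {F : ι → U.Star σ → U.Star σ} {X Y : Set (U.Star σ)} (hX : U.IsCD X)
    (hF : ∀ i, InternalFun (F i)) (hcount : (Set.range F).Countable)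
    (hκ : ∀ S : Set ι, U.IsCD (κ ⁻¹' S)) (hinj : ∀ i, Set.InjOn (F i) (X ∩ κ ⁻¹' {i}))
    (hmaps : ∀ i, Set.MapsTo (F i) (X ∩ κ ⁻¹' {i}) (Y ∩ κ ⁻¹' {i})) : U.CDLe X Y := by
  obtain ⟨e, he⟩ := hcount.exists_eq_range (Set.range_nonempty F)
  have hθ : CDMap (fun x => F (κ x) x) X := by
    refine ⟨ℕ, inferInstance, e, fun n => κ ⁻¹' {i | F i = e n}, fun n => ?_, fun n => hκ _,
      fun x _ => ?_, fun n x hx => congrFun hx.2 x⟩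
    · obtain ⟨i, hi⟩ : e n ∈ Set.range F := he ▸ Set.mem_range_self n
      exact hi ▸ hF i
    · obtain ⟨n, hn⟩ : F (κ x) ∈ Set.range e := he ▸ Set.mem_range_self (κ x)
      exact Set.mem_iUnion.2 ⟨n, hn.symm⟩
  refine hθ.cdLe hX (fun x hx => (hmaps _ ⟨hx, rfl⟩).1) fun x hx x' hx' h => ?_
  have hfiber : κ x = κ x' :=
    (hmaps _ ⟨hx, rfl⟩).2.symm.trans ((congrArg κ h).trans (hmaps _ ⟨hx', rfl⟩).2)
  refine hinj (κ x') ⟨hx, hfiber⟩ ⟨hx', rfl⟩ ?_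
  simpa only [hfiber] using h

theorem cdLe_digitMonadUnion_of_isNegligible_diff {d : U.Star .nat} (hd : U.IsInfinite d)
    {X : Set (U.Star .nat)} (hX : U.IsCD X) {G : Set (ℕ → Fin 2)} (hG : G.Nonempty)
    (h : U.IsNegligible d (X \ U.digitMonadUnion d G)) : U.CDLe X (U.digitMonadUnion d G) := by
  classical
  obtain ⟨Z, hZ, hXZ⟩ := h
  obtain ⟨g, hg⟩ := hG
  obtain ⟨F, hF, hinj, hmaps⟩ := exists_internalFun_mapsTo_digitMonad hd g hZ
  let E := U.ext Z ∪ U.digitMonad d g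
  have hE : U.IsCD E := by
    have hcompl := ((isInternal_ext Z).isCD.compl.inter (isCD_digitMonad d g).compl).compl
    rwa [← Set.compl_union, compl_compl] at hcompl
  refine cdLe_of_fiberwise (κ := (· ∈ E)) (F := fun p => if p then F else id) hX (fun p => ?_)
    (Set.countable_range _)
    (fun S => isCD_of_isCD (ι := Unit) (fun _ => hE) fun T => (() ∈ T) ∈ S) ?_ ?_
  · split_ifs
    exacts [hF, internalFun_id]
  · rintro p x ⟨-, rfl⟩ x' ⟨-, hx'⟩
    have hiff : x' ∈ E ↔ x ∈ E := iff_of_eq hx'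
    by_cases hxE : x ∈ E
    · simpa only [hxE, if_true] using hinj hxE (hiff.2 hxE)
    · simp only [hxE, if_false, id, imp_self]
  · rintro p x ⟨hx, rfl⟩
    by_cases hxE : x ∈ E
    · have hFx : F x ∈ U.digitMonad d g := hmaps hxE
      simp only [hxE, if_true]
      exact ⟨⟨hFx.1, hFx.2 ▸ hg⟩, eq_true (Or.inr hFx)⟩
    · simp only [hxE, if_false, id]
      exact ⟨by_contra fun hxG => hxE (Or.inl (hXZ ⟨hx, hxG⟩)), eq_false hxE⟩

theorem digitMonadUnion_cdLe {d : U.Star .nat} {G : Set (ℕ → Fin 2)} {X : Set (U.Star .nat)}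
    (hG : ∀ g ∈ G, ∃ F : U.Star .nat → U.Star .nat, InternalFun F ∧
      Set.InjOn F (U.digitMonad d g) ∧ Set.MapsTo F (U.digitMonad d g) (U.digitMonad d g ∩ X))
    (hcount : {g ∈ G | ¬ U.digitMonad d g ⊆ X}.Countable) : U.CDLe (U.digitMonadUnion d G) X := by
  classical
  choose! F hF hinj hmaps using hG
  let N := {g ∈ G | ¬ U.digitMonad d g ⊆ X}
  refine cdLe_of_fiberwise (κ := U.leadingDigits d) (F := fun g => if g ∈ N then F g else id)
    (isCD_digitMonadUnion d G) (fun g => ?_) ?_ (isCD_leadingDigits_preimage d) ?_ ?_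
  · split_ifs with hg
    exacts [hF g hg.1, internalFun_id]
  · refine ((hcount.image F).insert id).mono ?_
    rintro _ ⟨g, rfl⟩
    by_cases hg : g ∈ N
    exacts [.inr ⟨g, hg, (if_pos hg).symm⟩, .inl (if_neg hg)]
  · rintro g x ⟨hx, rfl⟩ x' ⟨hx', hg⟩
    split_ifs with hN
    exacts [fun h => hinj _ hx.2 ⟨hx.1, rfl⟩ ⟨hx'.1, hg⟩ h, id]
  · rintro g x ⟨hx, rfl⟩
    split_ifs with hN
    · obtain ⟨hFx, hFX⟩ := hmaps _ hx.2 ⟨hx.1, rfl⟩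
      exact ⟨hFX, hFx.2⟩
    · have hsub : U.digitMonad d (U.leadingDigits d x) ⊆ X :=
        by_contra fun h => hN ⟨hx.2, h⟩
      exact ⟨hsub ⟨hx.1, rfl⟩, rfl⟩

theorem countable_of_lt_of_pairwise_le {ι α : Type*} [LinearOrder α] [Countable α]
    {u v : ι → Lex (ℕ → α)} (huv : ∀ i, u i < v i)
    (h : Pairwise fun i j => v i ≤ u j ∨ v j ≤ u i) : Countable ι := by
  choose n hn hlt using huv
  let code : ι → ℕ × List α := fun i => (n i, (List.range (n i + 1)).map (ofLex (v i)))
  have hcode : ∀ i j, code i = code j → ¬ v i ≤ u j := fun i j hij => by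
    obtain ⟨hnij, hv⟩ := Prod.mk.inj hij
    have hv' : ∀ m ≤ n j, v i m = v j m := fun m hm => by
      rw [hnij] at hv
      exact List.map_inj_left.1 hv m (List.mem_range.2 (Nat.lt_succ_of_le hm))
    refine not_le_of_gt ⟨n j, fun m hm => (hn j m hm).trans (hv' m hm.le).symm, ?_⟩
    exact (hlt j).trans_eq (hv' _ le_rfl).symm
  refine Function.Injective.countable (f := code) fun i j hij => by_contra fun hne => ?_
  exact (h hne).elim (hcode i j hij) (hcode j i hij.symm)

theorem countable_setOf_not_constant {α : Type*} [LinearOrder α] [Countable α] {d : U.Star .nat}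
    (hd : U.IsInfinite d) {s : U.Star .nat → Lex (ℕ → α)}
    (hs : ∀ y ∈ U.segment d, ∀ y' ∈ U.segment d, U.NatRel (· < ·) y y' → s y ≤ s y') :
    {g | ∃ y ∈ U.digitMonad d g, ∃ y' ∈ U.digitMonad d g, s y ≠ s y'}.Countable := by
  have hlt : ∀ g : {g | ∃ y ∈ U.digitMonad d g, ∃ y' ∈ U.digitMonad d g, s y ≠ s y'},
      ∃ y ∈ U.digitMonad d g, ∃ y' ∈ U.digitMonad d g, s y < s y' := by
    rintro ⟨g, y, hy, y', hy', hne⟩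
    exact hne.lt_or_gt.elim (⟨y, hy, y', hy', ·⟩) (⟨y', hy', y, hy, ·⟩)
  choose y hy y' hy' hlt using hlt
  refine countable_of_lt_of_pairwise_le hlt fun g g' hne => ?_
  rcases lt_or_gt_of_ne (a := toLex g.1) (b := toLex g'.1) fun h => hne (Subtype.ext h) with
    ⟨n, h, hn⟩ | ⟨n, h, hn⟩
  · exact .inl (hs _ (hy' g).1 _ (hy g').1 (natRel_lt_of_mem_digitMonad hd (hy' g) (hy g') h hn))
  · exact .inr (hs _ (hy' g').1 _ (hy g).1 (natRel_lt_of_mem_digitMonad hd (hy' g') (hy g) h hn))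

/-- The sequence of truth values `x ∈ A m`. Sequences are ordered lexicographically, with
`False < True`. -/
def signature {α : Type*} (A : ℕ → Set α) (x : α) : Lex (ℕ → Prop) :=
  toLex fun m => x ∈ A m

variable (U) in
/-- The numbers that share the first `k` leading digits with `g` and the first `k` entries of the
signature with `b`. -/
def signatureBlock (d : U.Star .nat) (A : ℕ → Set (U.Star .nat)) (g : ℕ → Fin 2)
    (b : Lex (ℕ → Prop)) (k : ℕ) : Set (U.Star .nat) :=
  U.ext (U.digitBlock d k (prefixNum g k)) ∩ {y | ∀ m < k, (y ∈ A m ↔ b m)}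

theorem isInternal_signatureBlock {A : ℕ → Set (U.Star .nat)} (hA : ∀ m, U.IsInternal (A m))
    (d : U.Star .nat) (g : ℕ → Fin 2) (b : Lex (ℕ → Prop)) (k : ℕ) :
    U.IsInternal (U.signatureBlock d A g b k) :=
  (isInternal_ext _).inter (IsInternal.forall_lt (fun m => (hA m).mem_iff (b m)) k)

theorem antitone_signatureBlock {d : U.Star .nat} (hd : U.IsInfinite d)
    (A : ℕ → Set (U.Star .nat)) (g : ℕ → Fin 2) (b : Lex (ℕ → Prop)) :
    Antitone (U.signatureBlock d A g b) :=
  fun _ _ h _ hy => ⟨antitone_ext_digitBlock hd g h hy.1, fun m hm => hy.2 m (hm.trans_le h)⟩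

theorem signatureBlock_subset_segment {d : U.Star .nat} (hd : U.IsInfinite d)
    (A : ℕ → Set (U.Star .nat)) (g : ℕ → Fin 2) (b : Lex (ℕ → Prop)) (k : ℕ) :
    U.signatureBlock d A g b k ⊆ U.segment d := fun y hy => by
  have hzero := mem_ext_digitBlock.1 (antitone_ext_digitBlock hd g (Nat.zero_le k) hy.1)
  exact hzero.mono fun p hp => by simpa [prefixNum] using hp

theorem iInter_signatureBlock {d : U.Star .nat} (hd : U.IsInfinite d) (A : ℕ → Set (U.Star .nat))
    (g : ℕ → Fin 2) (b : Lex (ℕ → Prop)) :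
    ⋂ k, U.signatureBlock d A g b k = U.digitMonad d g ∩ {y | signature A y = b} := by
  have hsignature : {y | signature A y = b} = ⋂ k, {y | ∀ m < k, (y ∈ A m ↔ b m)} := by
    ext y
    rw [Set.mem_iInter]
    exact ⟨fun h k m _ => iff_of_eq (congrFun h m),
      fun h => funext fun m => propext (h (m + 1) m m.lt_succ_self)⟩
  rw [digitMonad_eq_iInter hd, hsignature, ← Set.iInter_inter_distrib]
  rfl

theorem isNegligible_setOf_mem_signatureBlock (d : U.Star .nat) (A : ℕ → Set (U.Star .nat)) :
    U.IsNegligible d {y | ∃ g b k, U.IsNegligible d (U.signatureBlock d A g b k) ∧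
      y ∈ U.signatureBlock d A g b k} := by
  let block : ℕ × ℕ × Finset ℕ → Set (U.Star .nat) := fun p =>
    U.ext (U.digitBlock d p.1 p.2.1) ∩ cylinder A (p.1, p.2.2)
  obtain ⟨Z, hZ, hsub⟩ := isNegligible_iUnion (X := fun p : {p // U.IsNegligible d (block p)} =>
    block p) Subtype.property
  refine ⟨Z, hZ, ?_⟩
  rintro y ⟨g, b, k, hneg, hy⟩
  obtain ⟨t, ht⟩ := exists_cylinder_eq A b k
  have hblock : U.signatureBlock d A g b k = block (k, prefixNum g k, t) := by
    rw [signatureBlock, ← ht]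
  rw [hblock] at hneg hy
  exact hsub (Set.mem_iUnion.2 ⟨⟨_, hneg⟩, hy⟩)

theorem isNegligible_or_cdEquiv_digitMonadUnion {d : U.Star .nat} (hd : U.IsInfinite d)
    {A : ℕ → Set (U.Star .nat)} (hA : ∀ m, U.IsInternal (A m))
    (hmono : ∀ y ∈ U.segment d, ∀ y' ∈ U.segment d, U.NatRel (· < ·) y y' →
      signature A y ≤ signature A y')
    (B : Set (Lex (ℕ → Prop))) :
    U.IsNegligible d {y ∈ U.segment d | signature A y ∈ B} ∨
      ∃ G, U.CDEquiv {y ∈ U.segment d | signature A y ∈ B} (U.digitMonadUnion d G) := by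
  set X := {y ∈ U.segment d | signature A y ∈ B}
  let G : Set (ℕ → Fin 2) :=
    {g | ∃ b ∈ B, ∀ k, ¬ U.IsNegligible d (U.signatureBlock d A g b k)}
  have hX : U.IsCD X := (isInternal_segment d).isCD.inter
    (isCD_of_isInternal hA fun S => toLex (· ∈ S) ∈ B)
  obtain ⟨Z, hZ, hblocks⟩ := isNegligible_setOf_mem_signatureBlock d A
  have hXG : U.IsNegligible d (X \ U.digitMonadUnion d G) := by
    refine ⟨Z, hZ, fun y ⟨⟨hy, hyB⟩, hyG⟩ => by_contra fun hyZ => hyG ?_⟩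
    refine ⟨hy, signature A y, hyB, fun k hk => hyZ (hblocks ⟨_, _, k, hk, ?_⟩)⟩
    exact Set.iInter_subset _ k ((iInter_signatureBlock hd A _ _).superset ⟨⟨hy, rfl⟩, rfl⟩)
  rcases G.eq_empty_or_nonempty with hG | hG
  · have hempty : U.digitMonadUnion d G = ∅ :=
      Set.eq_empty_iff_forall_notMem.2 fun y hy => Set.notMem_empty _ (hG ▸ hy.2)
    rw [hempty, Set.sdiff_empty] at hXG
    exact .inl hXG
  have hmove : ∀ g ∈ G, ∃ F : U.Star .nat → U.Star .nat, InternalFun F ∧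
      Set.InjOn F (U.digitMonad d g) ∧ Set.MapsTo F (U.digitMonad d g) (U.digitMonad d g ∩ X) := by
    rintro g ⟨b, hb, hlarge⟩
    obtain ⟨F, hF, hinj, hmaps⟩ := exists_internalFun_digitMonad_mapsTo_iInter hd g
      (isInternal_signatureBlock hA d g b) (antitone_signatureBlock hd A g b)
      (signatureBlock_subset_segment hd A g b) hlarge
    rw [iInter_signatureBlock hd] at hmaps
    exact ⟨F, hF, hinj, hmaps.mono_right fun y hy => ⟨hy.1, hy.1.1, hy.2.symm ▸ hb⟩⟩
  refine .inr ⟨G, cdLe_digitMonadUnion_of_isNegligible_diff hd hX hG hXG,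
    digitMonadUnion_cdLe hmove ((countable_setOf_not_constant hd hmono).mono ?_)⟩
  rintro g ⟨hg, hsub⟩
  obtain ⟨y, hy, hyX⟩ := Set.not_subset.1 hsub
  obtain ⟨F, -, -, hmaps⟩ := hmove g hg
  exact ⟨y, hy, F y, (hmaps hy).1, fun h => hyX ⟨hy.1, h ▸ (hmaps hy).2.2⟩⟩

/-! ### Sorting by signatures -/

theorem exists_bijOn_monotoneOn_comp {α : Type*} [LinearOrder α] (f : ℕ → α) (N : ℕ) :
    ∃ s : ℕ → ℕ, Set.BijOn s (Set.Iio N) (Set.Iio N) ∧ MonotoneOn (f ∘ s) (Set.Iio N) := by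
  let e : Equiv.Perm (Fin N) := Tuple.sort fun i => f i
  let s : ℕ → ℕ := fun i => if h : i < N then e ⟨i, h⟩ else i
  have hs : ∀ i (h : i < N), s i = e ⟨i, h⟩ := fun i h => dif_pos h
  refine ⟨s, ⟨fun i hi => ?_, fun i hi j hj hij => ?_, fun j hj => ?_⟩, fun i hi j hj hij => ?_⟩
  · exact Set.mem_Iio.2 (hs i hi ▸ Fin.is_lt _)
  · rw [hs i hi, hs j hj] at hij
    exact congrArg Fin.val (e.injective (Fin.ext hij))
  · refine ⟨e.symm ⟨j, hj⟩, Fin.is_lt _, ?_⟩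
    simp only [hs _ (Fin.is_lt _), Fin.eta, e.apply_symm_apply]
  · simp only [Function.comp_apply, hs i hi, hs j hj]
    exact Tuple.monotone_sort (fun i : Fin N => f i) (show (⟨i, hi⟩ : Fin N) ≤ ⟨j, hj⟩ from hij)

theorem exists_bijOn_segment_monotone_signature (d : U.Star .nat) {A : ℕ → Set (U.Star .nat)}
    (hA : ∀ m, U.IsInternal (A m)) : ∃ F : U.Star .nat → U.Star .nat, InternalFun F ∧
      Set.BijOn F (U.segment d) (U.segment d) ∧
      ∀ y ∈ U.segment d, ∀ y' ∈ U.segment d, U.NatRel (· < ·) y y' →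
        signature (fun m => F ⁻¹' A m) y ≤ signature (fun m => F ⁻¹' A m) y' := by
  choose S hS using hA
  obtain ⟨H, hH⟩ := exists_map_section_eq S
  obtain ⟨z, rfl, rfl⟩ := exists_joint d H
  choose s hbij hmono using fun p : ℕ × Set (ℕ × ℕ) =>
    exists_bijOn_monotoneOn_comp (signature fun m => {b | (m, b) ∈ p.2}) (2 ^ p.1)
  have hmem : ∀ m x, app (σ := .nat) (τ := .nat) s z x ∈ A m ↔
      U.Rel (ρ := .prod .nat (.pow (.prod .nat .nat))) (σ := .nat)
        (fun p x => (m, s p x) ∈ p.2) z x := by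
    intro m x
    rw [← hS, ← hH, map_map (τ := .pow (.prod .nat .nat)), mem_ext_map, rel_app]
    exact Iff.rfl
  have hsegment := segment_map (U := U) (z := z) (δ := Prod.fst)
  refine ⟨app (σ := .nat) (τ := .nat) s z, internalFun_app _ _, ?_, fun y hy y' hy' hlt => ?_⟩
  · rw [hsegment]
    refine ⟨mapsTo_app_iff.2 (holds_of_forall fun p => (hbij p).mapsTo),
      injOn_app_iff.2 (holds_of_forall fun p => (hbij p).injOn), ?_⟩
    rw [Set.SurjOn, image_app_ext, ext_map_subset_iff]
    exact holds_of_forall fun p => (hbij p).surjOn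
  by_contra hle
  obtain ⟨m, heq, hm⟩ := not_le.1 hle
  have hdiff : (∀ l < m, (app s z y' ∈ A l ↔ app s z y ∈ A l)) ∧
      app s z y ∈ A m ∧ app s z y' ∉ A m :=
    ⟨fun l hl => iff_of_eq (heq l hl), of_not_not fun h => hm.not_ge fun h' => (h h').elim,
      fun h => hm.not_ge fun _ => h⟩
  simp only [hmem] at hdiff
  obtain ⟨w, rfl, rfl, rfl⟩ := exists_joint₃ z y y'
  rw [segment, Set.mem_ofPred] at hy'
  simp only [map_map, NatRel, rel_map, ← holds_iff, ← holds_forall_lt, ← holds_not, ← holds_and]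
    at hy' hlt hdiff
  refine holds_const.1 (hy'.mono₃ hlt hdiff fun p hp hpq ⟨h, hm, hm'⟩ => ?_)
  refine (hmono p.1 (hpq.trans hp) hp hpq.le).not_gt ⟨m, fun l hl => ?_, ?_⟩
  · exact propext (h l hl)
  · exact ⟨fun h => (hm' h).elim, fun h => hm' (h hm)⟩

theorem exists_cdEquiv_monotone_signature {d : U.Star .nat} {X : Set (U.Star .nat)}
    (hX : U.IsCD X) (hXd : X ⊆ U.segment d) :
    ∃ (A : ℕ → Set (U.Star .nat)) (B : Set (Lex (ℕ → Prop))), (∀ m, U.IsInternal (A m)) ∧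
      (∀ y ∈ U.segment d, ∀ y' ∈ U.segment d, U.NatRel (· < ·) y y' →
        signature A y ≤ signature A y') ∧
      U.CDEquiv X {y ∈ U.segment d | signature A y ∈ B} := by
  obtain ⟨A, B, hA, rfl⟩ := hX.exists_eq
  obtain ⟨F, hF, hbij, hmono⟩ := exists_bijOn_segment_monotone_signature d hA
  have hA' : ∀ m, U.IsInternal (F ⁻¹' A m) := fun m => (hA m).preimage hF
  refine ⟨fun m => F ⁻¹' A m, {b | {m | (ofLex b : ℕ → Prop) m} ∈ B}, hA', hmono, ?_⟩
  set X' := {y ∈ U.segment d |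
    signature (fun m => F ⁻¹' A m) y ∈ {b | {m | (ofLex b : ℕ → Prop) m} ∈ B}}
  have hX' : U.IsCD X' := (isInternal_segment d).isCD.inter (isCD_of_isInternal hA' (· ∈ B))
  have himage : F '' X' = {x | {m | x ∈ A m} ∈ B} := by
    refine Set.Subset.antisymm (Set.image_subset_iff.2 fun y hy => hy.2) fun x hx => ?_
    obtain ⟨y, hy, rfl⟩ := hbij.surjOn (hXd hx)
    exact ⟨y, ⟨hy, hx⟩, rfl⟩
  rw [← himage]
  exact ((hF.cdMap X').cdEquiv_image hX' (hbij.injOn.mono fun y hy => hy.1)).symm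

/-! ### Reduction of `cℕ` to `[0, c)` -/

theorem countable_setOf_eventuallyEq {α : Type*} [Countable α] (g : ℕ → α) :
    {h : ℕ → α | h =ᶠ[Filter.atTop] g}.Countable := by
  refine (Set.countable_range fun (l : List α) i => l.getD i (g i)).mono fun h hh => ?_
  obtain ⟨k, hk⟩ := Filter.eventually_atTop.1 hh
  refine ⟨(List.range k).map h, funext fun i => ?_⟩
  rcases lt_or_ge i k with hi | hi
  · simp [hi]
  · simp [hi, hk i hi]

theorem infinite_setOf_eventuallyEq {α : Type*} [Nontrivial α] (g : ℕ → α) :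
    {h : ℕ → α | h =ᶠ[Filter.atTop] g}.Infinite := by
  choose a ha using fun n => exists_ne (g n)
  refine Set.infinite_of_injective_forall_mem (f := fun n => Function.update g n (a n)) ?_ ?_
  · refine fun m n h => by_contra fun hne => ha m ?_
    simpa [hne] using congrFun h m
  · exact fun n => (Filter.eventually_gt_atTop n).mono fun i hi => Function.update_of_ne hi.ne' _ _

theorem exists_injective_eventuallyEq (α : Type*) [Countable α] [Nontrivial α] :
    ∃ φ : (ℕ → α) × ℕ → ℕ → α, Function.Injective φ ∧ ∀ p, φ p =ᶠ[Filter.atTop] p.1 := by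
  let r : (ℕ → α) → ℕ → α := fun g => Quotient.out (g : Filter.Germ Filter.atTop α)
  have hr : ∀ g, r g =ᶠ[Filter.atTop] g := fun g => Filter.Germ.coe_eq.1 (Quotient.out_eq _)
  have hr_congr : ∀ g h, g =ᶠ[Filter.atTop] h → r g = r h := fun g h hgh =>
    congrArg Quotient.out (Filter.Germ.coe_eq.2 hgh)
  have hcode : ∀ g : ℕ → α, ∃ c : (ℕ → α) × ℕ → ℕ → α,
      Set.InjOn c {p | p.1 =ᶠ[Filter.atTop] g} ∧ ∀ p, c p =ᶠ[Filter.atTop] g := fun g => by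
    have hcount := (countable_setOf_eventuallyEq g).prod (Set.countable_univ (α := ℕ))
    obtain ⟨f, hf⟩ := Set.countable_iff_exists_injOn.1 hcount
    let e := (infinite_setOf_eventuallyEq g).natEmbedding
    exact ⟨fun p => e (f p), fun p hp q hq h =>
      hf ⟨hp, trivial⟩ ⟨hq, trivial⟩ (e.injective (Subtype.ext h)), fun p => (e (f p)).2⟩
  choose c hinj hc using hcode
  have hφ : ∀ p, c (r p.1) p =ᶠ[Filter.atTop] p.1 := fun p => (hc _ p).trans (hr _)
  refine ⟨fun p => c (r p.1) p, fun p q h => ?_, hφ⟩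
  have hrpq : r p.1 = r q.1 := hr_congr _ _ ((hφ p).symm.trans (.trans (.of_eq h) (hφ q)))
  refine hinj (r q.1) (hrpq ▸ (hr p.1).symm) (hr q.1).symm ?_
  simpa only [hrpq] using h

theorem prefixNum_div_two_pow (g : ℕ → Fin 2) (k n : ℕ) :
    prefixNum g (k + n) / 2 ^ n = prefixNum g k := by
  induction n with
  | zero => exact Nat.div_one _
  | succ n ih =>
    rw [pow_succ', ← Nat.div_div_eq_div_mul, ← add_assoc, prefixNum_succ_div_two, ih]

theorem prefixNum_lt_two_pow (g : ℕ → Fin 2) (k : ℕ) : prefixNum g k < 2 ^ k := by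
  have h := prefixNum_div_two_pow g 0 k
  rw [zero_add] at h
  exact (Nat.div_eq_zero_iff_lt (Nat.two_pow_pos k)).1 h

/-- The replacement of the leading digits of `x` by those of `t`, where `t < 2 ^ k` is regarded as a
string of `k` digits and `x` as one of `d` digits. -/
def replacePrefix (k t d x : ℕ) : ℕ :=
  2 ^ (d - k) * t + x % 2 ^ (d - k)

theorem replacePrefix_div (k t d x : ℕ) : replacePrefix k t d x / 2 ^ (d - k) = t := by
  have h : 0 < 2 ^ (d - k) := Nat.two_pow_pos _
  rw [replacePrefix, Nat.mul_add_div h, Nat.div_eq_of_lt (Nat.mod_lt x h), add_zero]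

theorem replacePrefix_lt {k t d : ℕ} (ht : t < 2 ^ k) (hk : k ≤ d) (x : ℕ) :
    replacePrefix k t d x < 2 ^ d := by
  rw [← Nat.add_sub_of_le hk, pow_add, ← Nat.div_lt_iff_lt_mul (Nat.two_pow_pos _),
    Nat.add_sub_of_le hk, replacePrefix_div]
  exact ht

theorem digit_replacePrefix_of_lt {k d j : ℕ} (hj : j < k) (hk : k ≤ d) (g : ℕ → Fin 2) (x : ℕ) :
    replacePrefix k (prefixNum g k) d x / 2 ^ (d - (j + 1)) % 2 = g j := by
  have hd : d - (j + 1) = d - k + (k - (j + 1)) := by lia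
  have hdiv := prefixNum_div_two_pow g (j + 1) (k - (j + 1))
  rw [Nat.add_sub_of_le hj] at hdiv
  rw [hd, pow_add, ← Nat.div_div_eq_div_mul, replacePrefix_div, hdiv, prefixNum, Nat.mul_add_mod]
  exact Nat.mod_eq_of_lt (g j).2

theorem digit_replacePrefix_of_le {k d j : ℕ} (hk : k ≤ j) (hj : j < d) (t x : ℕ) :
    replacePrefix k t d x / 2 ^ (d - (j + 1)) % 2 = x / 2 ^ (d - (j + 1)) % 2 := by
  have hmod : replacePrefix k t d x ≡ x [MOD 2 ^ (d - k)] := by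
    rw [replacePrefix, Nat.ModEq, Nat.mul_add_mod, Nat.mod_mod]
  have hdvd : 2 ^ (d - (j + 1)) * 2 ∣ 2 ^ (d - k) :=
    pow_succ 2 (d - (j + 1)) ▸ pow_dvd_pow 2 (by lia)
  rw [← Nat.mod_mul_right_div_self, hmod.of_dvd hdvd, Nat.mod_mul_right_div_self]

theorem div_two_pow_sub_congr {d k x y : ℕ} (hk : k ≤ d) (hxy : x / 2 ^ d = y / 2 ^ d)
    (h : ∀ i < k, x / 2 ^ (d - (i + 1)) % 2 = y / 2 ^ (d - (i + 1)) % 2) :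
    x / 2 ^ (d - k) = y / 2 ^ (d - k) := by
  induction k with
  | zero => exact hxy
  | succ k ih =>
    have hdiv := ih (Nat.le_of_lt hk) fun i hi => h i (hi.trans k.lt_succ_self)
    rw [← div_two_pow_sub_succ_div_two hk, ← div_two_pow_sub_succ_div_two hk] at hdiv
    rw [← Nat.div_add_mod (x / _) 2, hdiv, h k k.lt_succ_self, Nat.div_add_mod]

theorem eq_of_replacePrefix_eq {k t d x y : ℕ} (h : x / 2 ^ (d - k) = y / 2 ^ (d - k))
    (hxy : replacePrefix k t d x = replacePrefix k t d y) : x = y := by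
  rw [← Nat.div_add_mod x (2 ^ (d - k)), h, Nat.add_left_cancel hxy, Nat.div_add_mod]

theorem app_replacePrefix_mem_digitMonad {d x : U.Star .nat} (hd : U.IsInfinite d)
    {g : ℕ → Fin 2} {k : ℕ} (h : ∀ i ≥ k, g i = U.leadingDigits d x i) :
    app (ρ := .nat) (σ := .nat) (τ := .nat) (replacePrefix k (prefixNum g k)) d x ∈
      U.digitMonad d g := by
  refine ⟨?_, funext fun j => leadingDigits_eq_iff.2 ?_⟩
  · rw [segment, Set.mem_ofPred, NatRel, rel_app]
    exact (holds_pair_fst.2 (hd k)).mono fun p hk =>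
      replacePrefix_lt (prefixNum_lt_two_pow g k) (Nat.le_of_lt hk) p.2
  rw [NatRel, rel_app]
  rcases lt_or_ge j k with hj | hj
  · exact (holds_pair_fst.2 (hd k)).mono fun p hk =>
      digit_replacePrefix_of_lt hj (Nat.le_of_lt hk) g p.2
  · exact (leadingDigits_eq_iff.1 (h j hj).symm).mono₂ (holds_pair_fst.2 (hd j)) fun p hp hjd =>
      (digit_replacePrefix_of_le hj hjd _ p.2).trans hp

theorem eq_of_app_replacePrefix_eq {d x y : U.Star .nat} (hd : U.IsInfinite d) {k t n : ℕ}
    (hx : U.NatRel (fun d x => x / 2 ^ d = n) d x) (hy : U.NatRel (fun d x => x / 2 ^ d = n) d y)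
    (hdigits : U.leadingDigits d x = U.leadingDigits d y)
    (h : app (ρ := .nat) (σ := .nat) (τ := .nat) (replacePrefix k t) d x =
      app (ρ := .nat) (σ := .nat) (τ := .nat) (replacePrefix k t) d y) : x = y := by
  have hdigit := fun i => leadingDigits_eq_iff.1 (congrFun hdigits i)
  have hdigit' := fun i => leadingDigits_eq_iff.1 (rfl : U.leadingDigits d y i = _)
  have hk := hd k
  generalize U.leadingDigits d y = g at hdigit hdigit'
  obtain ⟨w, rfl, rfl, rfl⟩ := exists_joint₃ d x y
  simp only [NatRel, rel_map] at hx hy hdigit hdigit'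
  rw [app_map, app_map, ← holds_eq] at h
  rw [← holds_eq]
  have hcongr : U.Holds w fun p : ℕ × ℕ × ℕ => ∀ i < k,
      p.2.1 / 2 ^ (p.1 - (i + 1)) % 2 = p.2.2 / 2 ^ (p.1 - (i + 1)) % 2 :=
    holds_forall_lt.2 fun i _ => (hdigit i).mono₂ (hdigit' i) fun p hp hp' => hp.trans hp'.symm
  refine (holds_and.2 ⟨hx, hy⟩).mono₃ (holds_and.2 ⟨hcongr, h⟩) (holds_map.1 hk) ?_
  rintro p ⟨hpx, hpy⟩ ⟨hcongr, h⟩ hk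
  exact eq_of_replacePrefix_eq
    (div_two_pow_sub_congr (Nat.le_of_lt hk) (hpx.trans hpy.symm) hcongr) h

theorem exists_natRel_div_eq {d x : U.Star .nat} (hx : x ∈ U.mulCut (U.htwoPow d)) :
    ∃ n : ℕ, U.NatRel (fun d x => x / 2 ^ d = n) d x := by
  obtain ⟨n, hn⟩ := mem_mulCut_htwoPow.1 hx
  by_contra! h
  have hne : ∀ m < n, ¬ U.NatRel (fun d x => x / 2 ^ d = m) d x := fun m _ => h m
  simp only [NatRel, Rel, ← holds_not, ← holds_forall_lt] at hne
  exact holds_const.1 (hn.mono₂ hne fun p hp hne => hne _ (Nat.div_lt_of_lt_mul hp) rfl)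

theorem exists_subset_segment_cdEquiv {d : U.Star .nat} (hd : U.IsInfinite d)
    {X : Set (U.Star .nat)} (hX : U.IsCD X) (hXd : X ⊆ U.mulCut (U.htwoPow d)) :
    ∃ Y ⊆ U.segment d, U.CDEquiv X Y := by
  obtain ⟨φ, hφ, htail⟩ := exists_injective_eventuallyEq (Fin 2)
  choose κ hκ using fun p => Filter.eventually_atTop.1 (htail p)
  choose! ν hν using fun x (hx : x ∈ X) => exists_natRel_div_eq (hXd hx)
  have hν_eq : ∀ x ∈ X, ∀ n, U.NatRel (fun d x => x / 2 ^ d = n) d x → ν x = n := fun x hx n hn =>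
    holds_const.1 ((hν x hx).mono₂ hn fun p h h' => h.symm.trans h')
  let p : U.Star .nat → (ℕ → Fin 2) × ℕ := fun x => (U.leadingDigits d x, ν x)
  let F : ℕ × ℕ → U.Star .nat → U.Star .nat := fun i =>
    app (ρ := .nat) (σ := .nat) (τ := .nat) (replacePrefix i.1 i.2) d
  let shift : (ℕ → Fin 2) × ℕ → ℕ × ℕ := fun q => (κ q, prefixNum (φ q) (κ q))
  let θ : U.Star .nat → U.Star .nat := fun x => F (shift (p x)) x
  have hmem : ∀ x, θ x ∈ U.digitMonad d (φ (p x)) := fun x =>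
    app_replacePrefix_mem_digitMonad hd (hκ (p x))
  have hinj : Set.InjOn θ X := fun x hx y hy hxy => by
    have hp : p x = p y := hφ ((hmem x).2.symm.trans (hxy ▸ (hmem y).2))
    simp only [θ, hp] at hxy
    exact eq_of_app_replacePrefix_eq hd (hν x hx) ((Prod.mk.inj hp).2 ▸ hν y hy)
      (Prod.mk.inj hp).1 hxy
  have hθ : CDMap θ X := by
    refine ⟨ℕ × ℕ × ℕ, inferInstance, fun i => F i.2, fun i =>
      {x | U.NatRel (fun d x => x / 2 ^ d = i.1) d x} ∩
        U.leadingDigits d ⁻¹' {g | shift (g, i.1) = i.2}, fun i => internalFun_app _ _,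
      fun i => (isInternal_rel _ _).isCD.inter (isCD_leadingDigits_preimage d _),
      fun x hx => Set.mem_iUnion.2 ⟨(ν x, shift (p x)), hν x hx, rfl⟩, ?_⟩
    rintro ⟨n, i⟩ x ⟨hx, hn, hi⟩
    have hshift : shift (p x) = i := by rw [← hν_eq x hx n hn] at hi; exact hi
    simp only [θ, hshift]
  exact ⟨θ '' X, Set.image_subset_iff.2 fun x _ => (hmem x).1, hθ.cdEquiv_image hX hinj⟩

/-! ### Internal binary sequences -/

/-- The graph of the sequence of the binary digits of `y < 2 ^ d`, the leading one first. -/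
def digitGraph (d y : ℕ) : Set (ℕ × ℕ) :=
  {q | q.1 < d ∧ q.2 = y / 2 ^ (d - (q.1 + 1)) % 2}

/-- Graphs of functions `[0, d) → {0, 1}`. -/
def IsBinaryGraph (d : ℕ) (S : Set (ℕ × ℕ)) : Prop :=
  (∀ q ∈ S, q.1 < d ∧ q.2 < 2) ∧ ∀ k < d, ∃! i, (k, i) ∈ S

theorem mk_mem_digitGraph {d y k i : ℕ} :
    (k, i) ∈ digitGraph d y ↔ k < d ∧ i = y / 2 ^ (d - (k + 1)) % 2 :=
  Iff.rfl

theorem isBinaryGraph_digitGraph (d y : ℕ) : IsBinaryGraph d (digitGraph d y) := by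
  refine ⟨fun q hq => ⟨hq.1, hq.2 ▸ Nat.mod_lt _ two_pos⟩, fun k hk => ?_⟩
  simp only [mk_mem_digitGraph, hk, true_and, existsUnique_eq]

theorem IsBinaryGraph.eq_of_subset {d : ℕ} {S T : Set (ℕ × ℕ)} (hS : IsBinaryGraph d S)
    (hT : IsBinaryGraph d T) (h : S ⊆ T) : S = T := by
  refine h.antisymm fun ⟨k, i⟩ hi => ?_
  obtain ⟨hk, -⟩ := hT.1 _ hi
  obtain ⟨j, hj, -⟩ := hS.2 k hk
  rwa [(hT.2 k hk).unique hi (h hj)]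

theorem injOn_digitGraph (d : ℕ) : Set.InjOn (digitGraph d) (Set.Iio (2 ^ d)) := by
  intro x hx y hy h
  have hdigit : ∀ k < d, x / 2 ^ (d - (k + 1)) % 2 = y / 2 ^ (d - (k + 1)) % 2 := fun k hk =>
    (mk_mem_digitGraph.1 (h ▸ mk_mem_digitGraph.2 ⟨hk, rfl⟩)).2
  have htop : x / 2 ^ d = y / 2 ^ d := by rw [Nat.div_eq_of_lt hx, Nat.div_eq_of_lt hy]
  simpa using div_two_pow_sub_congr le_rfl htop hdigit

theorem prefixNum_digit (g : ℕ → Fin 2) {d k : ℕ} (hk : k < d) :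
    prefixNum g d / 2 ^ (d - (k + 1)) % 2 = g k := by
  conv_lhs => rw [← Nat.add_sub_cancel' (Nat.succ_le_of_lt hk)]
  rw [Nat.add_sub_cancel_left, prefixNum_div_two_pow, prefixNum, Nat.mul_add_mod]
  exact Nat.mod_eq_of_lt (g k).2

theorem bijOn_digitGraph (d : ℕ) :
    Set.BijOn (digitGraph d) (Set.Iio (2 ^ d)) {S | IsBinaryGraph d S} := by
  refine ⟨fun y _ => isBinaryGraph_digitGraph d y, injOn_digitGraph d, fun S hS => ?_⟩
  have hvalue : ∀ k, ∃ v : Fin 2, k < d → (k, (v : ℕ)) ∈ S := fun k => by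
    by_cases hk : k < d
    · obtain ⟨i, hi, -⟩ := hS.2 k hk
      exact ⟨⟨i, (hS.1 _ hi).2⟩, fun _ => hi⟩
    · exact ⟨0, fun h => absurd h hk⟩
  choose g hg using hvalue
  refine ⟨prefixNum g d, prefixNum_lt_two_pow g d,
    (isBinaryGraph_digitGraph d _).eq_of_subset hS ?_⟩
  rintro ⟨k, i⟩ h
  obtain ⟨hk, rfl⟩ := mk_mem_digitGraph.1 h
  exact prefixNum_digit g hk ▸ hg k hk

theorem rel_isBinaryGraph_iff {d : U.Star .nat} {S : U.Star (.pow (.prod .nat .nat))} :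
    U.Rel (ρ := .nat) (σ := .pow (.prod .nat .nat)) IsBinaryGraph d S ↔ S ∈ U.internalSeqs d := by
  have hbound : ∀ k i, U.Rel (ρ := .prod .nat (.pow (.prod .nat .nat))) (σ := .prod .nat .nat)
      (fun a q => q ∈ a.2 → q.1 < a.1 ∧ q.2 < 2) (U.pair d S) (U.pair k i) ↔
      (U.pair k i ∈ U.ext S → U.hlt k d ∧ U.hlt i (U.hnat 2)) := fun k i => by
    obtain ⟨v, rfl, rfl⟩ := exists_joint d S
    obtain ⟨w, rfl, rfl, rfl⟩ := exists_joint₃ v k i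
    simp only [map_map (τ := .prod .nat (.pow (.prod .nat .nat))), hnat_eq_map 2 w, pair_map,
      hlt_map, mem_ext_iff, rel_map, ← holds_imp, ← holds_and]
  have hmem : ∀ k i, U.Rel (ρ := .prod (.prod .nat (.pow (.prod .nat .nat))) .nat) (σ := .nat)
      (fun a i => (a.2, i) ∈ a.1.2) (U.pair (U.pair d S) k) i ↔
        U.pair k i ∈ U.ext S := fun k i => by
    obtain ⟨v, rfl, rfl⟩ := exists_joint d S
    obtain ⟨w, rfl, rfl, rfl⟩ := exists_joint₃ v k i
    simp only [map_map (τ := .prod .nat (.pow (.prod .nat .nat))), pair_map, mem_ext_iff, rel_map]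
  have hlt : ∀ k, U.Rel (ρ := .prod .nat (.pow (.prod .nat .nat))) (σ := .nat)
      (fun a k => k < a.1) (U.pair d S) k ↔ U.hlt k d := fun k => by
    obtain ⟨w, rfl, rfl, rfl⟩ := exists_joint₃ d S k
    rw [pair_map, rel_map, hlt_map]
  rw [Rel]
  simp only [IsBinaryGraph]
  rw [holds_and, holds_forall (τ := .prod .nat .nat), holds_forall (τ := .nat), forall_star_prod]
  refine and_congr (forall₂_congr hbound) (forall_congr' fun k => ?_)
  rw [Rel, holds_imp, holds_existsUnique (τ := .nat)]
  exact imp_congr (hlt k) (existsUnique_congr (hmem k))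

theorem segment_eq_ext (d : U.Star .nat) :
    U.segment d = U.ext (U.map (σ := .nat) (τ := .pow .nat) (fun d => Set.Iio (2 ^ d)) d) := by
  rw [← segment_map, U.map_id]

theorem injOn_app_digitGraph (d : U.Star .nat) :
    Set.InjOn (app (ρ := .nat) (σ := .nat) (τ := .pow (.prod .nat .nat)) digitGraph d)
      (U.segment d) := by
  rw [segment_eq_ext, injOn_app_iff]
  exact holds_of_forall injOn_digitGraph

theorem image_app_digitGraph (d : U.Star .nat) :
    app (ρ := .nat) (σ := .nat) (τ := .pow (.prod .nat .nat)) digitGraph d '' U.segment d =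
      U.internalSeqs d := by
  rw [segment_eq_ext, image_app_ext]
  simp only [(bijOn_digitGraph _).image_eq]
  exact Set.ext fun S => mem_ext_map.trans rel_isBinaryGraph_iff

theorem pair_hnat_mem_ext_app_digitGraph_iff {d y : U.Star .nat} (hd : U.IsInfinite d) {n : ℕ}
    {v : Fin 2} :
    U.pair (U.hnat n) (U.hnat v) ∈
        U.ext (app (ρ := .nat) (σ := .nat) (τ := .pow (.prod .nat .nat)) digitGraph d y) ↔
      U.leadingDigits d y n = v := by
  rw [leadingDigits_eq_iff]
  have hn := hd n
  obtain ⟨w, rfl, rfl⟩ := exists_joint d y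
  rw [holds_map] at hn
  rw [hnat_eq_map n w, hnat_eq_map v w, app_map, pair_map, map_mem_ext_map, NatRel, rel_map]
  exact ⟨fun h => h.mono fun p hp => hp.2.symm, fun h => hn.mono₂ h fun p hlt hp => ⟨hlt, hp.symm⟩⟩

theorem cdEquiv_monadUnion {d : U.Star .nat} (hd : U.IsInfinite d) (G : Set (ℕ → Fin 2)) :
    U.CDEquiv (U.digitMonadUnion d G) (U.monadUnion d G) := by
  let F : U.Star .nat → U.Star (.pow (.prod .nat .nat)) := app (ρ := .nat) (σ := .nat) digitGraph d
  have himage : F '' U.digitMonadUnion d G = U.monadUnion d G := by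
    have hpreimage : U.digitMonadUnion d G = U.segment d ∩
        F ⁻¹' {S | ∃ g ∈ G, ∀ n, U.pair (U.hnat n) (U.hnat (g n : ℕ)) ∈ U.ext S} := by
      ext y
      simp only [F, digitMonadUnion, Set.mem_inter_iff, Set.mem_preimage, Set.mem_ofPred,
        pair_hnat_mem_ext_app_digitGraph_iff hd, ← funext_iff, exists_eq_right']
    rw [hpreimage, Set.image_inter_preimage, image_app_digitGraph]
    rfl
  have hF : InternalFun F := internalFun_app _ _
  rw [← himage]
  exact (hF.cdMap _).cdEquiv_image (isCD_digitMonadUnion d G)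
    ((injOn_app_digitGraph d).mono fun y hy => hy.1)

/-! ### Comparison with `c/ℕ` -/

theorem IsSmall.cdLe_divCut {d : U.Star .nat} (hd : U.IsInfinite d) {Z : U.Star (.pow σ)}
    (hZ : U.IsSmall d Z) : U.CDLe (U.ext Z) (U.divCut (U.htwoPow d)) := by
  obtain ⟨S, hS, hcard⟩ := hZ.exists_subset_divCut hd
  have hfin := holds_pair_snd.1 ((hZ 0).mono fun p hp => hp.1)
  obtain ⟨F, hF, hinj, hmaps⟩ := exists_internalFun_injOn_mapsTo_of_ncard_le (V := fun _ => Z)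
    (W := fun _ => S) antitone_const antitone_const fun _ =>
      (holds_pair_fst.2 hfin).mono₂ (hcard 1) fun p hp h =>
        ⟨hp, Set.finite_of_ncard_pos (Nat.zero_lt_of_lt h), ((one_mul _).symm.trans_lt h).le⟩
  exact (hF.cdMap _).cdLe (isInternal_ext Z).isCD (fun x hx => hS (hmaps 0 hx)) hinj

theorem IsNegligible.cdLt_divCut {d : U.Star .nat} (hd : U.IsInfinite d) {X : Set (U.Star σ)}
    (h : U.IsNegligible d X) (hX : U.IsCD X) : U.CDLt X (U.divCut (U.htwoPow d)) := by
  obtain ⟨Z, hZ, hXZ⟩ := h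
  have hle : U.CDLe X (U.ext Z) := CDLe.of_subset hX hXZ
  exact ⟨hle.trans (hZ.cdLe_divCut hd), fun hge => not_cdLe_divCut_of_isSmall hd hZ (hge.trans hle)⟩

end NonstandardUniverse

theorem mainTheorem7 (U : NonstandardUniverse.{u}) (c d : U.Star StdType.nat)
    (hcd : c = U.htwoPow d) (hc : ∀ n : ℕ, c ≠ U.hnat n)
    (X : Set (U.Star StdType.nat)) (hX : X ⊆ U.mulCut c) (hCD : U.IsCD X) :
    U.CDLt X (U.divCut c) ∨ ∃ G : Set (ℕ → Fin 2), U.CDEquiv X (U.monadUnion d G) := by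
  subst hcd
  have hd : U.IsInfinite d := NonstandardUniverse.isInfinite_of_htwoPow_ne hc
  obtain ⟨Y, hYd, hXY⟩ := NonstandardUniverse.exists_subset_segment_cdEquiv hd hCD hX
  obtain ⟨A, B, hA, hmono, hYW⟩ :=
    NonstandardUniverse.exists_cdEquiv_monotone_signature hXY.2.isCD hYd
  have hXW := hXY.trans hYW
  obtain hnegl | ⟨G, hWG⟩ :=
    NonstandardUniverse.isNegligible_or_cdEquiv_digitMonadUnion hd hA hmono B
  · exact Or.inl (hXW.trans_cdLt (hnegl.cdLt_divCut hd hXW.2.isCD))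
  · exact Or.inr ⟨G, hXW.trans (hWG.trans (NonstandardUniverse.cdEquiv_monadUnion hd G))⟩
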